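/- Let $n\ge 4$ be an even integer, let $u\in C^\infty(\mathbb{R}^n)$, and consider the conformal metric $g=e^{2u}|dx|^2$ on $\mathbb{R}^n$. Let $R_g$ be the scalar curvature of $g$, and let $Q$ be its Q-curvature, that is, the function determined by $(-\Delta)^{n/2}u=Q\,e^{nu}$, where $\Delta$ is the Euclidean Laplacian. Assume that $g$ has finite total Q-curvature, i.e. $Qe^{nu}\in L^1(\mathbb{R}^n)$, and that $R_g\ge 0$ outside some compact subset of $\mathbb{R}^n$. If $$\int_{\mathbb{R}^n}Qe^{nu}\,dx<\frac{(n-1)!\,|\mathbb{S}^n|}{2},$$ where $|\mathbb{S}^n|$ denotes the volume of the standard unit $n$-sphere, then the metric $g$ is complete. -/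

import Mathlib

open MeasureTheory
open scoped ContDiff Manifold Laplacian

noncomputable section

/-- `ℝⁿ` with its Euclidean norm. -/
abbrev Euc (n : ℕ) : Type := EuclideanSpace ℝ (Fin n)

/-- A field of bilinear forms on `ℝⁿ`, given by its components `g_{ij}(x)` in the standard
coordinates. -/
abbrev MetricField (n : ℕ) : Type := Euc n → Matrix (Fin n) (Fin n) ℝ

/-- The conformal metric `g = e^{2u} |dx|²`. -/
def conformalMetric {n : ℕ} (u : Euc n → ℝ) : MetricField n :=
  fun x => Real.exp (2 * u x) • (1 : Matrix (Fin n) (Fin n) ℝ)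

/-! ### Curvature in the standard coordinates -/

/-- The partial derivative `∂_i f`. -/
def partialDeriv {n : ℕ} (i : Fin n) (f : Euc n → ℝ) (x : Euc n) : ℝ :=
  fderiv ℝ f x (EuclideanSpace.single i 1)

/-- The Christoffel symbol
`Γ^k_{ij} = (1/2) ∑_l g^{kl} (∂_i g_{jl} + ∂_j g_{il} - ∂_l g_{ij})`. -/
def christoffel {n : ℕ} (g : MetricField n) (k i j : Fin n) (x : Euc n) : ℝ :=
  (1 / 2) * ∑ l, (g x)⁻¹ k l *
    (partialDeriv i (fun y => g y j l) x + partialDeriv j (fun y => g y i l) x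
      - partialDeriv l (fun y => g y i j) x)

/-- The Ricci tensor
`R_{ij} = ∑_k (∂_k Γ^k_{ij} - ∂_j Γ^k_{ik}) + ∑_{k,l} (Γ^k_{kl} Γ^l_{ij} - Γ^k_{jl} Γ^l_{ik})`
(positive on round spheres). -/
def ricciTensor {n : ℕ} (g : MetricField n) (i j : Fin n) (x : Euc n) : ℝ :=
  ∑ k, (partialDeriv k (christoffel g k i j) x - partialDeriv j (christoffel g k i k) x)
    + ∑ k, ∑ l, (christoffel g k k l x * christoffel g l i j x
        - christoffel g k j l x * christoffel g l i k x)

/-- The scalar curvature `R_g = ∑_{i,j} g^{ij} R_{ij}`. -/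
def scalarCurvature {n : ℕ} (g : MetricField n) (x : Euc n) : ℝ :=
  ∑ i, ∑ j, (g x)⁻¹ i j * ricciTensor g i j x

/-- The Q-curvature of `g = e^{2u} |dx|²` on `ℝⁿ`, `n` even: the function `Q` determined by
`(-Δ)^{n/2} u = Q e^{nu}`, with `Δ` the Euclidean Laplacian. -/
def qCurvature {n : ℕ} (u : Euc n → ℝ) (x : Euc n) : ℝ :=
  Real.exp (-(n * u x)) * (fun f : Euc n → ℝ => -Δ f)^[n / 2] u x

/-- The volume `|𝕊ⁿ|` of the standard unit sphere in `ℝ^{n+1}`. -/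
def sphereVolume (n : ℕ) : ℝ :=
  (volume : Measure (Euc (n + 1))).toSphere.real Set.univ

/-! ### The distance of a metric and completeness -/

/-- The length `√(g_x(v, v))` of a tangent vector `v` at `x`. -/
def tangentLength {n : ℕ} (g : MetricField n) (x v : Euc n) : ℝ :=
  √(∑ i, ∑ j, g x i j * v i * v j)

theorem tangentLength_smul {n : ℕ} (g : MetricField n) (x : Euc n) (c : ℝ) (v : Euc n) :
    tangentLength g x (c • v) = |c| * tangentLength g x v := by
  unfold tangentLength
  rw [← Real.sqrt_sq_eq_abs, ← Real.sqrt_mul (sq_nonneg c), Finset.mul_sum]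
  congr 1
  refine Finset.sum_congr rfl fun i _ => ?_
  rw [Finset.mul_sum]
  refine Finset.sum_congr rfl fun j _ => ?_
  simp only [PiLp.smul_apply, smul_eq_mul]
  ring

/-- The norm that the metric puts on each tangent space of `ℝⁿ`. -/
@[reducible] def tangentENorm {n : ℕ} (g : MetricField n) (x : Euc n) :
    ENorm (TangentSpace 𝓘(ℝ, Euc n) x) :=
  ⟨fun v => ENNReal.ofReal (tangentLength g x v)⟩

theorem tangentENorm_smulClass {n : ℕ} (g : MetricField n) (x : Euc n) :
    letI := tangentENorm g x
    ENormSMulClass ℝ (TangentSpace 𝓘(ℝ, Euc n) x) :=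
  let _ := tangentENorm g x
  ⟨fun c v => by
    have h (w : Euc n) : ENNReal.ofReal (tangentLength g x (c • w)) =
        ‖c‖ₑ * ENNReal.ofReal (tangentLength g x w) := by
      rw [tangentLength_smul, ENNReal.ofReal_mul (abs_nonneg c), Real.enorm_eq_ofReal_abs]
    exact h v⟩

/-- The geodesic distance of a metric on `ℝⁿ`: the infimum of the lengths of the `C¹` curves that
join the two points. -/
def geodesicEDist {n : ℕ} (g : MetricField n) (x y : Euc n) : ENNReal :=
  letI := tangentENorm g
  Manifold.riemannianEDist 𝓘(ℝ, Euc n) x y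

/-- `ℝⁿ` with the geodesic distance of `g`, and the uniformity of that distance. -/
@[reducible] def geodesicSpace {n : ℕ} (g : MetricField n) : PseudoEMetricSpace (Euc n) where
  edist := geodesicEDist g
  edist_self x := by
    let _ := tangentENorm g
    have _ := tangentENorm_smulClass g
    exact Manifold.riemannianEDist_self
  edist_comm x y := by
    let _ := tangentENorm g
    have _ := tangentENorm_smulClass g
    exact Manifold.riemannianEDist_comm
  edist_triangle x y z := by
    let _ := tangentENorm g
    have _ := tangentENorm_smulClass g
    exact Manifold.riemannianEDist_triangle

/-- The metric is complete: Cauchy sequences for its geodesic distance converge. -/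
def IsCompleteMetric {n : ℕ} (g : MetricField n) : Prop :=
  @CompleteSpace (Euc n) (geodesicSpace g).toUniformSpace

end

/-! For `n = 2m`, the formula for the scalar curvature of `e^{2u}|dx|²` turns `R_g ≥ 0` into `c|∇u|²
≤ -Δu` near infinity, with `c = (n-2)/2 > 0`. This inequality is used in two ways.

On spheres, let `v_k(r)` be the integral of `(-Δ)^k u(rθ)` over unit vectors `θ`. The divergence
theorem gives `r^{n-1} v_k' = -∫₀^r s^{n-1} v_{k+1}`, and Cauchy–Schwarz gives the Riccati
inequality `v_1 ≥ (c/σ)(v_0')²`, where `σ = |𝕊^{n-1}|`. The Riccati inequality rules out polynomial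
growth: no `v_k` with `k ≥ 1` can stay away from zero. Integrating the system down from `k = m`,
where the total Q-curvature `I` enters, gives `r v_0' → -I/(2^{m-1}(m-1)!)²`
(`tendsto_mul_deriv_of_radial_system`). Since `(n-1)!|𝕊ⁿ|/2 = σ(2^{m-1}(m-1)!)²`
(`factorial_mul_sphereVolume`), the hypothesis on `I` says that this limit exceeds `-σ`, so the mean
of `u` over the sphere of radius `r` is at least `-log r - C`.

Pointwise, `u` is superharmonic near infinity, hence bounded below by its averages on balls.
Caccioppoli's inequality bounds the gradient scale-invariantly, so ball averages centred on one
sphere differ by a bounded amount, and `u` is at least its spherical mean minus a constant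
(`exists_sphereIntegral_le`).

Together, `e^u ≥ a/(1+|x|)`. Since `∫ dr/(1+r)` diverges, infinity is at infinite distance, and
completeness follows as in Hopf–Rinow (`isCompleteMetric_of_exp_ge`). -/

/-! ### Laplacian in coordinates, Green's identity, rescaling -/

theorem partialDeriv_contDiff {n : ℕ} {f : Euc n → ℝ} (hf : ContDiff ℝ ∞ f) (i : Fin n) :
    ContDiff ℝ ∞ (partialDeriv i f) :=
  (hf.fderiv_right (m := ∞) (by simp)).clm_apply contDiff_const

theorem laplacian_eq_sum_partialDeriv {n : ℕ} {f : Euc n → ℝ} (hf : ContDiff ℝ ∞ f) (x : Euc n) :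
    Δ f x = ∑ i, partialDeriv i (partialDeriv i f) x := by
  have h2 : ContDiff ℝ ∞ (fderiv ℝ f) := hf.fderiv_right (by simp)
  rw [InnerProductSpace.laplacian_eq_iteratedFDeriv_orthonormalBasis f
    (EuclideanSpace.basisFun (Fin n) ℝ)]
  refine Finset.sum_congr rfl fun i _ => ?_
  have hd : DifferentiableAt ℝ (fderiv ℝ f) x := (h2.differentiable (by simp)) x
  rw [iteratedFDeriv_two_apply]
  change _ = fderiv ℝ (fun y => fderiv ℝ f y (EuclideanSpace.single i 1)) x _
  rw [fderiv_clm_apply hd (differentiableAt_const _)]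
  simp [ContinuousLinearMap.flip_apply]

theorem contDiff_laplacian {n : ℕ} {f : Euc n → ℝ} (hf : ContDiff ℝ ∞ f) :
    ContDiff ℝ ∞ (Δ f) := by
  have : Δ f = fun x => ∑ i, partialDeriv i (partialDeriv i f) x :=
    funext (laplacian_eq_sum_partialDeriv hf)
  rw [this]
  exact ContDiff.sum fun i _ => partialDeriv_contDiff (partialDeriv_contDiff hf i) i

theorem contDiff_iterate_neg_laplacian {n : ℕ} {f : Euc n → ℝ} (hf : ContDiff ℝ ∞ f) (k : ℕ) :
    ContDiff ℝ ∞ ((fun f : Euc n → ℝ => -Δ f)^[k] f) := by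
  induction k with
  | zero => exact hf
  | succ k ih =>
    rw [Function.iterate_succ_apply']
    exact (contDiff_laplacian ih).neg

theorem fderiv_apply_eq_sum_partialDeriv {n : ℕ} (f : Euc n → ℝ) (x v : Euc n) :
    fderiv ℝ f x v = ∑ i, v i * partialDeriv i f x := by
  have hv : v = ∑ i, v i • EuclideanSpace.single i (1 : ℝ) := by
    conv_lhs => rw [← (EuclideanSpace.basisFun (Fin n) ℝ).sum_repr v]
    simp
  conv_lhs => rw [hv]
  simp [partialDeriv]

theorem norm_fderiv_sq_eq_sum {n : ℕ} (f : Euc n → ℝ) (x : Euc n) :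
    ‖fderiv ℝ f x‖ ^ 2 = ∑ i, partialDeriv i f x ^ 2 := by
  set w : Euc n := WithLp.toLp 2 (fun i => partialDeriv i f x) with hw
  have h : fderiv ℝ f x = innerSL ℝ w := by
    ext v
    rw [fderiv_apply_eq_sum_partialDeriv]
    simp [PiLp.inner_apply, hw]
  rw [h, innerSL_apply_norm, EuclideanSpace.norm_sq_eq]
  simp [hw]

theorem continuous_fderiv_of_contDiff {n : ℕ} {f : Euc n → ℝ} (hf : ContDiff ℝ ∞ f) :
    Continuous (fderiv ℝ f) := hf.continuous_fderiv (by simp)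

/-- Green's first identity against a compactly supported function. -/
theorem integral_mul_laplacian {n : ℕ} {χ v : Euc n → ℝ} (hχ : ContDiff ℝ 1 χ)
    (hc : HasCompactSupport χ) (hv : ContDiff ℝ ∞ v) :
    ∫ x, χ x * Δ v x = -∫ x, ∑ i, partialDeriv i χ x * partialDeriv i v x := by
  have hχ' (i : Fin n) : Continuous (partialDeriv i χ) :=
    (hχ.continuous_fderiv (by simp)).clm_apply continuous_const
  have hcs (i : Fin n) : HasCompactSupport (partialDeriv i χ) :=
    hc.fderiv_apply (𝕜 := ℝ) (EuclideanSpace.single i 1)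
  have hp (i : Fin n) := partialDeriv_contDiff hv i
  have hpp (i : Fin n) := partialDeriv_contDiff (hp i) i
  have h1 (i : Fin n) : Integrable fun x => partialDeriv i χ x * partialDeriv i v x :=
    ((hχ' i).mul (hp i).continuous).integrable_of_hasCompactSupport (hcs i).mul_right
  have h2 (i : Fin n) : Integrable fun x => χ x * partialDeriv i (partialDeriv i v) x :=
    (hχ.continuous.mul (hpp i).continuous).integrable_of_hasCompactSupport hc.mul_right
  have h3 (i : Fin n) : Integrable fun x => χ x * partialDeriv i v x :=
    (hχ.continuous.mul (hp i).continuous).integrable_of_hasCompactSupport hc.mul_right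
  simp_rw [laplacian_eq_sum_partialDeriv hv, Finset.mul_sum]
  rw [integral_finsetSum _ fun i _ => h2 i, integral_finsetSum _ fun i _ => h1 i,
    ← Finset.sum_neg_distrib]
  refine Finset.sum_congr rfl fun i _ => ?_
  exact integral_mul_fderiv_eq_neg_fderiv_mul_of_integrable (h1 i) (h2 i) (h3 i)
    (fun x _ => (hχ.differentiable (by simp)) x)
    (fun x _ => ((hp i).differentiable (by simp)) x)

theorem partialDeriv_comp_norm_sq {n : ℕ} {Θ : ℝ → ℝ} (hΘ : Differentiable ℝ Θ) (i : Fin n)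
    (x : Euc n) :
    partialDeriv i (fun y => Θ (‖y‖ ^ 2)) x = 2 * x i * deriv Θ (‖x‖ ^ 2) := by
  have h1 : HasFDerivAt (fun y : Euc n => ‖y‖ ^ 2) (2 • innerSL ℝ x) x :=
    (hasStrictFDerivAt_norm_sq x).hasFDerivAt
  have h2 := (hΘ (‖x‖ ^ 2)).hasDerivAt.comp_hasFDerivAt x h1
  have h3 : partialDeriv i (fun y => Θ (‖y‖ ^ 2)) x =
      (deriv Θ (‖x‖ ^ 2) • (2 • innerSL ℝ x)) (EuclideanSpace.single i 1) := by
    unfold partialDeriv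
    rw [← h2.fderiv]; rfl
  rw [h3]
  simp [EuclideanSpace.inner_single_right]
  ring

theorem hasCompactSupport_comp_norm_sq {n : ℕ} {Θ : ℝ → ℝ} {B : ℝ}
    (hB : ∀ t, B ≤ t → Θ t = 0) : HasCompactSupport fun x : Euc n => Θ (‖x‖ ^ 2) := by
  refine HasCompactSupport.intro (isCompact_closedBall (0 : Euc n) (√(max B 0))) fun x hx => hB _ ?_
  rw [mem_closedBall_zero_iff, not_le] at hx
  have := Real.lt_sq_of_sqrt_lt hx
  exact (le_max_left _ _).trans this.le

/-- The gradient of `Θ(|x|²)` is `2Θ'(|x|²)x`, so only the radial derivative of `v` survives in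
Green's identity. This serves both the divergence theorem on balls and the mean value inequality. -/
theorem integral_radial_mul_laplacian {n : ℕ} {Θ : ℝ → ℝ} {v : Euc n → ℝ} {B : ℝ}
    (hΘ : ContDiff ℝ 1 Θ) (hB : ∀ t, B ≤ t → Θ t = 0) (hv : ContDiff ℝ ∞ v) :
    ∫ x, Θ (‖x‖ ^ 2) * Δ v x = -∫ x, 2 * deriv Θ (‖x‖ ^ 2) * fderiv ℝ v x x := by
  have h := integral_mul_laplacian (χ := fun x => Θ (‖x‖ ^ 2)) (hΘ.comp (contDiff_norm_sq ℝ))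
    (hasCompactSupport_comp_norm_sq hB) hv
  rw [h]
  congr 2
  funext x
  rw [fderiv_apply_eq_sum_partialDeriv, Finset.mul_sum]
  refine Finset.sum_congr rfl fun i _ => ?_
  rw [partialDeriv_comp_norm_sq (hΘ.differentiable (by simp))]
  ring

theorem partialDeriv_comp_affine {n : ℕ} {u : Euc n → ℝ} (hu : Differentiable ℝ u) (a : Euc n)
    (ρ : ℝ) (i : Fin n) :
    partialDeriv i (fun y => u (a + ρ • y)) = fun y => ρ * partialDeriv i u (a + ρ • y) := by
  funext y
  have h1 : HasFDerivAt (fun y : Euc n => a + ρ • y) (ρ • ContinuousLinearMap.id ℝ (Euc n)) y :=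
    ((hasFDerivAt_id y).const_smul ρ).const_add a
  have h2 := (hu (a + ρ • y)).hasFDerivAt.comp y h1
  have h3 : fderiv ℝ (fun y => u (a + ρ • y)) y = _ := h2.fderiv
  unfold partialDeriv
  rw [h3]
  simp

theorem fderiv_comp_affine {n : ℕ} {u : Euc n → ℝ} (hu : Differentiable ℝ u) (a : Euc n)
    (ρ : ℝ) (y : Euc n) :
    fderiv ℝ (fun y => u (a + ρ • y)) y = ρ • fderiv ℝ u (a + ρ • y) := by
  have h1 : HasFDerivAt (fun y : Euc n => a + ρ • y) (ρ • ContinuousLinearMap.id ℝ (Euc n)) y :=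
    ((hasFDerivAt_id y).const_smul ρ).const_add a
  have h2 := (hu (a + ρ • y)).hasFDerivAt.comp y h1
  have h3 : fderiv ℝ (fun y => u (a + ρ • y)) y = _ := h2.fderiv
  rw [h3]
  ext; simp

theorem laplacian_comp_affine {n : ℕ} {u : Euc n → ℝ} (hu : ContDiff ℝ ∞ u) (a : Euc n)
    (ρ : ℝ) (y : Euc n) :
    Δ (fun y => u (a + ρ • y)) y = ρ ^ 2 * Δ u (a + ρ • y) := by
  have hc : ContDiff ℝ ∞ fun y : Euc n => u (a + ρ • y) := by fun_prop
  rw [laplacian_eq_sum_partialDeriv hc, laplacian_eq_sum_partialDeriv hu, Finset.mul_sum]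
  refine Finset.sum_congr rfl fun i _ => ?_
  rw [partialDeriv_comp_affine (hu.differentiable (by simp))]
  have hp := (partialDeriv_contDiff hu i).differentiable (by simp)
  have h2 : Differentiable ℝ fun y => partialDeriv i u (a + ρ • y) := by fun_prop
  have h3 : partialDeriv i (fun y => ρ * partialDeriv i u (a + ρ • y)) y =
      ρ * partialDeriv i (fun y => partialDeriv i u (a + ρ • y)) y := by
    unfold partialDeriv at *
    rw [fderiv_const_mul (h2 y)]; simp
  rw [h3, partialDeriv_comp_affine hp]
  ring

/-! ### Curvature of a conformally flat metric -/

theorem inv_conformalMetric {n : ℕ} (u : Euc n → ℝ) (x : Euc n) :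
    (conformalMetric u x)⁻¹ = Real.exp (-(2 * u x)) • (1 : Matrix (Fin n) (Fin n) ℝ) := by
  refine Matrix.inv_eq_right_inv ?_
  rw [conformalMetric, smul_mul_smul_comm, ← Real.exp_add]
  simp

theorem partialDeriv_conformalMetric {n : ℕ} {u : Euc n → ℝ} (hu : ContDiff ℝ ∞ u)
    (i j l : Fin n) (x : Euc n) :
    partialDeriv i (fun y => conformalMetric u y j l) x =
      (if j = l then 1 else 0) * (2 * Real.exp (2 * u x) * partialDeriv i u x) := by
  have hd := hu.differentiable (by simp)
  unfold conformalMetric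
  by_cases h : j = l
  · simp only [Matrix.smul_apply, Matrix.one_apply, h, if_true, smul_eq_mul, mul_one]
    unfold partialDeriv
    rw [fderiv_exp ((hd x).const_mul 2), fderiv_const_mul (hd x)]
    simp; ring
  · simp [h, partialDeriv]

theorem christoffel_conformalMetric {n : ℕ} {u : Euc n → ℝ} (hu : ContDiff ℝ ∞ u)
    (k i j : Fin n) :
    christoffel (conformalMetric u) k i j = fun x =>
      (if j = k then 1 else 0) * partialDeriv i u x + (if i = k then 1 else 0) * partialDeriv j u x
        - (if i = j then 1 else 0) * partialDeriv k u x := by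
  funext x
  unfold christoffel
  have h : Real.exp (-(2 * u x)) * Real.exp (2 * u x) = 1 := by rw [← Real.exp_add]; simp
  simp_rw [inv_conformalMetric, partialDeriv_conformalMetric hu, Matrix.smul_apply,
    Matrix.one_apply, smul_eq_mul]
  rw [Finset.sum_eq_single k (fun l _ hl => by simp [Ne.symm hl]) (by simp), if_pos rfl]
  linear_combination ((if j = k then 1 else 0) * partialDeriv i u x +
    (if i = k then 1 else 0) * partialDeriv j u x
      - (if i = j then 1 else 0) * partialDeriv k u x) * h

theorem partialDeriv_christoffel_conformalMetric {n : ℕ} {u : Euc n → ℝ} (hu : ContDiff ℝ ∞ u)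
    (l k i j : Fin n) (x : Euc n) :
    partialDeriv l (christoffel (conformalMetric u) k i j) x =
      (if j = k then 1 else 0) * partialDeriv l (partialDeriv i u) x
        + (if i = k then 1 else 0) * partialDeriv l (partialDeriv j u) x
        - (if i = j then 1 else 0) * partialDeriv l (partialDeriv k u) x := by
  have hd (i : Fin n) : Differentiable ℝ (partialDeriv i u) :=
    (partialDeriv_contDiff hu i).differentiable (by simp)
  rw [christoffel_conformalMetric hu]
  have h (i : Fin n) := (hd i x).hasFDerivAt
  have e := (((h i).const_mul (if j = k then (1 : ℝ) else 0)).add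
    ((h j).const_mul (if i = k then (1 : ℝ) else 0))).sub
      ((h k).const_mul (if i = j then (1 : ℝ) else 0))
  conv_lhs => unfold partialDeriv
  refine (congrArg (fun L => L (EuclideanSpace.single l 1)) e.fderiv).trans ?_
  simp only [sub_apply, add_apply, smul_apply, smul_eq_mul]
  rfl

/-- The scalar curvature of `e^{2u} |dx|²`. -/
theorem scalarCurvature_conformalMetric {n : ℕ} {u : Euc n → ℝ} (hu : ContDiff ℝ ∞ u)
    (x : Euc n) :
    scalarCurvature (conformalMetric u) x = -Real.exp (-(2 * u x)) *
      (2 * (n - 1) * Δ u x + (n - 1) * (n - 2) * ‖fderiv ℝ u x‖ ^ 2) := by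
  set a : Fin n → ℝ := fun i => partialDeriv i u x with ha
  set H : Fin n → Fin n → ℝ := fun i j => partialDeriv i (partialDeriv j u) x with hH
  -- Each term is written with Kronecker deltas placed so that every delta collapses one of the sums
  -- over `k` and `l`.
  have h1 : ∑ i, ricciTensor (conformalMetric u) i i x =
      ∑ i, (∑ k, ((if i = k then 2 * H i i else 0) - H k k - H i i)
        + ∑ k, ∑ l, ((if i = l then 2 * a i ^ 2 else 0) - a l ^ 2 -
          ((if l = k then a i ^ 2 else 0) - (if i = k then a l ^ 2 else 0)
            - (if i = l then a k ^ 2 else 0)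
            + (if i = k then if i = l then 2 * a i ^ 2 else 0 else 0)))) := by
    refine Finset.sum_congr rfl fun i _ => ?_
    unfold ricciTensor
    congr 1
    · refine Finset.sum_congr rfl fun k _ => ?_
      rw [partialDeriv_christoffel_conformalMetric hu, partialDeriv_christoffel_conformalMetric hu]
      by_cases h : i = k
      · subst h; simp [hH]; ring
      · simp [hH, h]
    · refine Finset.sum_congr rfl fun k _ => Finset.sum_congr rfl fun l _ => ?_
      simp only [christoffel_conformalMetric hu]
      by_cases h : i = k
      · subst h
        by_cases h2 : i = l
        · subst h2; simp [ha]; ring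
        · simp [ha, h2, Ne.symm h2]
      · by_cases h2 : i = l
        · subst h2; simp [ha, h, Ne.symm h]; ring
        · by_cases h3 : l = k
          · subst h3; simp [ha, h]; ring
          · simp [ha, h, h2, h3, Ne.symm h3]; ring
  have h2 : scalarCurvature (conformalMetric u) x =
      Real.exp (-(2 * u x)) * ∑ i, ricciTensor (conformalMetric u) i i x := by
    unfold scalarCurvature
    rw [inv_conformalMetric, Finset.mul_sum]
    refine Finset.sum_congr rfl fun i _ => ?_
    simp [Matrix.one_apply]
  have h3 : Δ u x = ∑ i, H i i := laplacian_eq_sum_partialDeriv hu x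
  have h4 : ‖fderiv ℝ u x‖ ^ 2 = ∑ i, a i ^ 2 := norm_fderiv_sq_eq_sum u x
  rw [h2, h1, h3, h4]
  simp only [Finset.sum_add_distrib, Finset.sum_sub_distrib, Finset.sum_ite_irrel,
    Finset.sum_const_zero, Finset.sum_ite_eq, Finset.sum_ite_eq', Finset.mem_univ, if_true,
    Finset.sum_const, Finset.card_univ, Fintype.card_fin, nsmul_eq_mul]
  simp only [← Finset.mul_sum]
  ring

/-- The scalar curvature formula is divided by `2(n-1)e^{-2u}`. The sign of the curvature enters the
proof only through this inequality. -/
theorem laplacian_le_of_scalarCurvature_nonneg {n : ℕ} (hn : 2 ≤ n) {u : Euc n → ℝ}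
    (hu : ContDiff ℝ ∞ u) {x : Euc n} (h : 0 ≤ scalarCurvature (conformalMetric u) x) :
    ((n : ℝ) - 2) / 2 * ‖fderiv ℝ u x‖ ^ 2 ≤ -Δ u x := by
  rw [scalarCurvature_conformalMetric hu, neg_mul, neg_nonneg] at h
  have h1 := nonpos_of_mul_nonpos_right h (Real.exp_pos _)
  have hn' : (2 : ℝ) ≤ n := by exact_mod_cast hn
  have h2 : (2 * ((n : ℝ) - 1)) *
      (Δ u x + ((n : ℝ) - 2) / 2 * ‖fderiv ℝ u x‖ ^ 2) ≤ 0 := by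
    linarith
  have h3 := nonpos_of_mul_nonpos_right h2 (by linarith)
  linarith

/-! ### Comparison of derivatives at infinity and L'Hôpital's rule -/

section EventualComparison
open Filter Topology

/-- An eventual inequality between derivatives integrates up to a constant. -/
theorem exists_sub_le_of_eventually_deriv_le {f g f' g' : ℝ → ℝ}
    (hf : ∀ᶠ r in atTop, HasDerivAt f (f' r) r) (hg : ∀ᶠ r in atTop, HasDerivAt g (g' r) r)
    (h : ∀ᶠ r in atTop, g' r ≤ f' r) : ∃ C, ∀ᶠ r in atTop, g r - C ≤ f r := by
  obtain ⟨R, hR⟩ := eventually_atTop.1 (hf.and (hg.and h))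
  refine ⟨g R - f R, eventually_atTop.2 ⟨R, fun r hr => ?_⟩⟩
  have hd : ∀ x ∈ Set.Ici R, HasDerivAt (fun x => f x - g x) (f' x - g' x) x :=
    fun x hx => (hR x hx).1.sub (hR x hx).2.1
  have hm : MonotoneOn (fun x => f x - g x) (Set.Ici R) := by
    refine monotoneOn_of_deriv_nonneg (convex_Ici R)
      (fun x hx => (hd x hx).continuousAt.continuousWithinAt)
      (fun x hx => (hd x (interior_subset hx)).differentiableAt.differentiableWithinAt) ?_
    intro x hx
    rw [(hd x (interior_subset hx)).deriv]
    linarith [(hR x (interior_subset hx)).2.2]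
  have := hm Set.self_mem_Ici hr hr
  simp only at this
  linarith

/-- One half of L'Hôpital's rule. With `a < b < L`, integration gives `f ≥ b g - C`, and `(b - a) g`
eventually absorbs `C` because `g → ∞`. -/
theorem eventually_le_div_of_deriv {f g f' g' : ℝ → ℝ} {L : ℝ}
    (hf : ∀ᶠ r in atTop, HasDerivAt f (f' r) r) (hg : ∀ᶠ r in atTop, HasDerivAt g (g' r) r)
    (hg' : ∀ᶠ r in atTop, 0 < g' r) (hgt : Tendsto g atTop atTop)
    (h : ∀ a < L, ∀ᶠ r in atTop, a < f' r / g' r) :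
    ∀ a < L, ∀ᶠ r in atTop, a < f r / g r := by
  intro a ha
  obtain ⟨b, hab, hbL⟩ := exists_between ha
  obtain ⟨C, hC⟩ := exists_sub_le_of_eventually_deriv_le (f := f) (g := fun r => b * g r) hf
    (hg.mono fun r hr => hr.const_mul b) (by
      filter_upwards [h b hbL, hg'] with r h1 h2
      exact ((lt_div_iff₀ h2).1 h1).le)
  filter_upwards [hC, hgt.eventually_gt_atTop 0, hgt.eventually_gt_atTop (C / (b - a))]
    with r h1 h2 h3
  rw [lt_div_iff₀ h2]
  rw [div_lt_iff₀ (by linarith)] at h3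
  nlinarith

/-- L'Hôpital's rule at infinity in the case of an infinite denominator. -/
theorem tendsto_div_of_tendsto_deriv_div {f g f' g' : ℝ → ℝ} {L : ℝ}
    (hf : ∀ᶠ r in atTop, HasDerivAt f (f' r) r) (hg : ∀ᶠ r in atTop, HasDerivAt g (g' r) r)
    (hg' : ∀ᶠ r in atTop, 0 < g' r) (hgt : Tendsto g atTop atTop)
    (h : Tendsto (fun r => f' r / g' r) atTop (𝓝 L)) :
    Tendsto (fun r => f r / g r) atTop (𝓝 L) := by
  refine tendsto_order.2 ⟨eventually_le_div_of_deriv hf hg hg' hgt fun a ha =>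
    h.eventually_const_lt ha, fun a ha => ?_⟩
  have h2 : Tendsto (fun r => -f' r / g' r) atTop (𝓝 (-L)) := by
    simpa [neg_div] using h.neg
  have := eventually_le_div_of_deriv (f := fun r => -f r) (hf.mono fun r hr => hr.neg) hg hg' hgt
    (fun a ha => h2.eventually_const_lt ha) (-a) (by linarith)
  filter_upwards [this] with r hr
  rw [neg_div] at hr
  linarith

end EventualComparison

/-! ### Asymptotics of radial polyharmonic systems -/

section RadialSystem
open Filter Topology

/-- If the radial Laplacian `r^{1-n} (r^{n-1} v')' = -w` of `v` is eventually bounded away from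
zero, then `v'` grows at least linearly. -/
theorem eventually_deriv_le_of_source_ge {n : ℕ} (hn : 1 ≤ n) {p w : ℝ → ℝ} (hw : Continuous w)
    (hp : ∀ r > 0, r ^ (n - 1) * p r = -∫ s in (0 : ℝ)..r, s ^ (n - 1) * w s) {c : ℝ} (hc : 0 < c)
    (h : ∀ᶠ r in atTop, c ≤ w r) : ∀ᶠ r in atTop, p r ≤ -(c / (2 * n)) * r := by
  have hn0 : (0 : ℝ) < n := by exact_mod_cast hn
  have hcont : Continuous fun s : ℝ => s ^ (n - 1) * w s := by fun_prop
  have hF (r : ℝ) : HasDerivAt (fun r => ∫ s in (0 : ℝ)..r, s ^ (n - 1) * w s)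
      (r ^ (n - 1) * w r) r :=
    intervalIntegral.integral_hasDerivAt_right (hcont.intervalIntegrable _ _)
      (hcont.stronglyMeasurableAtFilter _ _) hcont.continuousAt
  have hG (r : ℝ) : HasDerivAt (fun r : ℝ => c / n * r ^ n) (c * r ^ (n - 1)) r := by
    have := (hasDerivAt_pow n r).const_mul (c / n)
    refine this.congr_deriv ?_
    field_simp
  obtain ⟨C, hC⟩ := exists_sub_le_of_eventually_deriv_le (Eventually.of_forall hF)
    (Eventually.of_forall hG) (by
      filter_upwards [h, eventually_gt_atTop 0] with r h1 h2
      rw [mul_comm]; gcongr)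
  -- Half of the main term `(c/n) r^n` absorbs the integration constant, hence the `2` in `c/(2n)`.
  have hlim : Tendsto (fun r : ℝ => c / (2 * n) * r ^ n) atTop atTop :=
    (tendsto_pow_atTop (by omega)).const_mul_atTop (by positivity)
  filter_upwards [hC, hlim.eventually_gt_atTop C, eventually_gt_atTop 0] with r h1 h2 h3
  have h4 := hp r h3
  have h5 : r ^ n = r ^ (n - 1) * r := by rw [← pow_succ]; congr 1; omega
  have h6 : r ^ (n - 1) * p r ≤ r ^ (n - 1) * (-(c / (2 * n)) * r) := by
    rw [h4]
    have : c / n * r ^ n = 2 * (c / (2 * n) * r ^ n) := by field_simp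
    have : r ^ (n - 1) * (-(c / (2 * n)) * r) = -(c / (2 * n) * r ^ n) := by rw [h5]; ring
    linarith
  exact le_of_mul_le_mul_left h6 (by positivity)

/-- A linear bound on `v'` integrates to a quadratic one on `v`. This passes divergence from one
function of the system to the preceding one. -/
theorem eventually_le_neg_of_source_ge {n : ℕ} (hn : 1 ≤ n) {v p w : ℝ → ℝ} (hw : Continuous w)
    (hv : ∀ r, HasDerivAt v (p r) r)
    (hp : ∀ r > 0, r ^ (n - 1) * p r = -∫ s in (0 : ℝ)..r, s ^ (n - 1) * w s) {c : ℝ} (hc : 0 < c)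
    (h : ∀ᶠ r in atTop, c ≤ w r) (a : ℝ) : ∀ᶠ r in atTop, v r ≤ -a := by
  have hn0 : (0 : ℝ) < n := by exact_mod_cast hn
  have h1 := eventually_deriv_le_of_source_ge hn hw hp hc h
  obtain ⟨C, hC⟩ := exists_sub_le_of_eventually_deriv_le (f := fun r => -v r)
    (g := fun r => c / (2 * n) * (r ^ 2 / 2))
    (Eventually.of_forall fun r => (hv r).neg)
    (Eventually.of_forall fun r => ((hasDerivAt_pow 2 r).div_const 2).const_mul (c / (2 * n)))
    (by filter_upwards [h1] with r hr; simp; linarith)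
  have hlim : Tendsto (fun r : ℝ => c / (2 * n) * (r ^ 2 / 2)) atTop atTop :=
    ((tendsto_pow_atTop (by norm_num)).atTop_div_const (by norm_num)).const_mul_atTop
      (by positivity)
  filter_upwards [hC, hlim.eventually_gt_atTop (C + a)] with r h2 h3
  linarith

/-- A Riccati inequality `w ≥ c p²` prevents the source `w` from staying away from zero. -/
theorem not_eventually_ge_of_riccati {n : ℕ} (hn : 1 ≤ n) {p w : ℝ → ℝ} (hw : Continuous w)
    (hp : ∀ r > 0, r ^ (n - 1) * p r = -∫ s in (0 : ℝ)..r, s ^ (n - 1) * w s)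
    {c : ℝ} (hc : 0 < c) (hR : ∀ᶠ r in atTop, c * p r ^ 2 ≤ w r) {ε : ℝ} (hε : 0 < ε) :
    ¬ ∀ᶠ r in atTop, ε ≤ w r := by
  intro h
  have hn0 : (0 : ℝ) < n := by exact_mod_cast hn
  have hple := eventually_deriv_le_of_source_ge hn hw hp hε h
  have hcont : Continuous fun s : ℝ => s ^ (n - 1) * w s := by fun_prop
  have hF (r : ℝ) : HasDerivAt (fun r => ∫ s in (0 : ℝ)..r, s ^ (n - 1) * w s)
      (r ^ (n - 1) * w r) r :=
    intervalIntegral.integral_hasDerivAt_right (hcont.intervalIntegrable _ _)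
      (hcont.stronglyMeasurableAtFilter _ _) hcont.continuousAt
  have hpd (r : ℝ) (hr : 0 < r) : HasDerivAt p (-w r - (n - 1 : ℕ) * p r / r) r := by
    have hq : HasDerivAt (fun r => -(∫ s in (0 : ℝ)..r, s ^ (n - 1) * w s) / r ^ (n - 1)) _ r :=
      (hF r).neg.div (hasDerivAt_pow (n - 1) r) (by positivity)
    have heq : p =ᶠ[𝓝 r] fun r => -(∫ s in (0 : ℝ)..r, s ^ (n - 1) * w s) / r ^ (n - 1) := by
      filter_upwards [lt_mem_nhds hr] with s hs
      rw [← hp s hs]; field_simp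
    refine (hq.congr_of_eventuallyEq heq).congr_deriv ?_
    have h1 := hp r hr
    have h2 : (-fun r => ∫ s in (0 : ℝ)..r, s ^ (n - 1) * w s) r = r ^ (n - 1) * p r := h1.symm
    rw [h2]
    -- The derivative of `r^{n-1}` contains the truncated exponent `n - 1 - 1`, so `n = 1` is
    -- treated apart.
    rcases Nat.eq_zero_or_pos (n - 1) with h0 | h0
    · simp [h0]
    · have h5 : r ^ (n - 1) = r ^ (n - 1 - 1) * r := by rw [← pow_succ]; congr 1; omega
      rw [h5]
      field_simp
  have hneg : ∀ᶠ r in atTop, p r < 0 := by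
    filter_upwards [hple, eventually_gt_atTop 0] with r h1 h2
    have : 0 < ε / (2 * n) * r := by positivity
    linarith
  -- Since `p → -∞`, the first-order term of `p' = -w - (n-1)p/r` costs at most half of `c p²`.
  have hbig : ∀ᶠ r in atTop, (n - 1 : ℕ) * (-p r) / r ≤ c / 2 * p r ^ 2 := by
    have hlim : Tendsto (fun r : ℝ => ε / (2 * n) * r) atTop atTop :=
      tendsto_id.const_mul_atTop (by positivity)
    filter_upwards [hple, hneg, eventually_ge_atTop 1,
      hlim.eventually_ge_atTop (2 * (n - 1 : ℕ) / c)] with r h1 h2 h3 h4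
    have h5 : 2 * (n - 1 : ℕ) / c ≤ -p r := by linarith
    rw [div_le_iff₀ hc] at h5
    rw [div_le_iff₀ (by linarith)]
    have h6 : (n - 1 : ℕ) * (-p r) ≤ c / 2 * p r ^ 2 := by nlinarith
    have h7 : 0 ≤ c / 2 * p r ^ 2 := by positivity
    nlinarith
  -- Now `(1/p)' = -p'/p² ≥ c/2`, so `1/p` tends to `+∞`, although `p` is eventually negative.
  obtain ⟨C, hC⟩ := exists_sub_le_of_eventually_deriv_le (f := fun r => (p r)⁻¹)
    (g := fun r => c / 2 * r) (f' := fun r => -(-w r - (n - 1 : ℕ) * p r / r) / p r ^ 2)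
    (g' := fun _ => c / 2)
    (by filter_upwards [hneg, eventually_gt_atTop 0] with r h1 h2
        exact (hpd r h2).inv h1.ne)
    (Eventually.of_forall fun r => by simpa using (hasDerivAt_id r).const_mul (c / 2))
    (by filter_upwards [hneg, hbig, hR] with r h1 h2 h3
        have : 0 < p r ^ 2 := sq_pos_of_neg h1
        rw [le_div_iff₀ this]
        have : (n - 1 : ℕ) * (-p r) / r = -((n - 1 : ℕ) * p r / r) := by ring
        linarith)
  have hlim : Tendsto (fun r : ℝ => c / 2 * r) atTop atTop :=
    tendsto_id.const_mul_atTop (by positivity)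
  obtain ⟨r, h1, h2, h3⟩ := (hC.and (hneg.and (hlim.eventually_gt_atTop C))).exists
  have : (p r)⁻¹ < 0 := inv_lt_zero.2 h2
  linarith

/-- The decay of one function of a radial polyharmonic system gives the decay of the derivative of
the preceding one. -/
theorem tendsto_pow_mul_deriv_of_source {n k : ℕ} (hk : 1 ≤ k) (hkn : 2 * k < n) {p w : ℝ → ℝ}
    (hw : Continuous w)
    (hp : ∀ r > 0, r ^ (n - 1) * p r = -∫ s in (0 : ℝ)..r, s ^ (n - 1) * w s) {b : ℝ}
    (h : Tendsto (fun r => r ^ (2 * k) * w r) atTop (𝓝 b)) :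
    Tendsto (fun r => r ^ (2 * k - 1) * p r) atTop (𝓝 (-(b / ((n - 2 * k : ℕ) : ℝ)))) := by
  have hcont : Continuous fun s : ℝ => s ^ (n - 1) * w s := by fun_prop
  have hF (r : ℝ) : HasDerivAt (fun r => ∫ s in (0 : ℝ)..r, s ^ (n - 1) * w s)
      (r ^ (n - 1) * w r) r :=
    intervalIntegral.integral_hasDerivAt_right (hcont.intervalIntegrable _ _)
      (hcont.stronglyMeasurableAtFilter _ _) hcont.continuousAt
  have hpos : (0 : ℝ) < (n - 2 * k : ℕ) := by
    have : 0 < n - 2 * k := by omega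
    exact_mod_cast this
  -- The integral is compared with `r^{n-2k}`, which is unbounded because `2k < n`.
  have key := tendsto_div_of_tendsto_deriv_div (L := b / ((n - 2 * k : ℕ) : ℝ))
    (Eventually.of_forall hF)
    (Eventually.of_forall fun r : ℝ => hasDerivAt_pow (n - 2 * k) r)
    (by filter_upwards [eventually_gt_atTop 0] with r hr; positivity)
    (tendsto_pow_atTop (by omega)) (by
      refine (h.div_const _).congr' ?_
      filter_upwards [eventually_gt_atTop 0] with r hr
      have : r ^ (n - 1) = r ^ (2 * k) * r ^ (n - 2 * k - 1) := by
        rw [← pow_add]; congr 1; omega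
      rw [this]; field_simp)
  refine key.neg.congr' ?_
  filter_upwards [eventually_gt_atTop 0] with r hr
  rw [← neg_div, ← hp r hr]
  have : r ^ (n - 1) = r ^ (2 * k - 1) * r ^ (n - 2 * k) := by rw [← pow_add]; congr 1; omega
  rw [this]; field_simp

/-- A function with derivative of order `r^{-2k-1}` and no nonzero limit has order `r^{-2k}`. -/
theorem tendsto_pow_mul_of_deriv {k : ℕ} (hk : 1 ≤ k) {v p : ℝ → ℝ}
    (hv : ∀ r, HasDerivAt v (p r) r) (hpc : Continuous p)
    (hnot : ∀ ε > 0, ¬ (∀ᶠ r in atTop, ε ≤ v r) ∧ ¬ ∀ᶠ r in atTop, v r ≤ -ε) {d : ℝ}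
    (h : Tendsto (fun r => r ^ (2 * k + 1) * p r) atTop (𝓝 (-d))) :
    Tendsto (fun r => r ^ (2 * k) * v r) atTop (𝓝 (d / (2 * k))) := by
  -- As `2k + 1 ≥ 2`, `p = O(r^{-2})` is integrable, so `v` has a limit; `hnot` forces the limit to
  -- be zero. The `0/0` form of L'Hôpital's rule against `r^{-2k}` then gives the rate.
  have hint : IntegrableOn p (Set.Ioi 1) := by
    have hO : p =O[atTop] fun r : ℝ => r ^ (-(2 : ℝ)) := by
      obtain ⟨C, hC⟩ := (h.isBigO_one ℝ).bound
      refine Asymptotics.IsBigO.of_bound C ?_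
      filter_upwards [hC, eventually_ge_atTop 1] with r h1 h2
      have hr : 0 < r := by linarith
      rw [Real.rpow_neg hr.le, Real.rpow_two, norm_inv, norm_pow, Real.norm_of_nonneg hr.le,
        ← div_eq_mul_inv, le_div_iff₀ (by positivity), mul_comm]
      rw [norm_mul, norm_pow, Real.norm_of_nonneg hr.le, norm_one, mul_one] at h1
      refine le_trans ?_ h1
      exact mul_le_mul_of_nonneg_right (pow_le_pow_right₀ h2 (by omega)) (norm_nonneg _)
    exact hpc.locallyIntegrable.locallyIntegrableOn _ |>.integrableOn_of_isBigO_atTop hO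
      (integrableAtFilter_rpow_atTop_iff.2 (by norm_num)) |>.mono_set Set.Ioi_subset_Ici_self
  have hlim := tendsto_limUnder_of_hasDerivAt_of_integrableOn_Ioi (fun r _ => hv r) hint
  set ℓ := limUnder atTop v
  have hℓ : ℓ = 0 := by
    by_contra hne
    rcases lt_or_gt_of_ne hne with hlt | hgt
    · exact (hnot (-ℓ / 2) (by linarith)).2
        ((hlim.eventually_lt_const (by linarith : ℓ < ℓ / 2)).mono fun r hr => by linarith)
    · exact (hnot (ℓ / 2) (by linarith)).1
        ((hlim.eventually_const_lt (by linarith : ℓ / 2 < ℓ)).mono fun r hr => hr.le)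
  rw [hℓ] at hlim
  have hk0 : (0 : ℝ) < 2 * k := by positivity
  have hpow : Tendsto (fun r : ℝ => (r ^ (2 * k))⁻¹) atTop (𝓝 0) :=
    (tendsto_pow_atTop (by omega)).inv_tendsto_atTop
  have key := HasDerivAt.lhopital_zero_atTop (l := 𝓝 (d / (2 * k)))
    (Eventually.of_forall hv)
    ((eventually_gt_atTop (0 : ℝ)).mono fun r hr =>
      (hasDerivAt_pow (2 * k) r).inv (by positivity))
    (by
      filter_upwards [eventually_gt_atTop 0] with r hr
      have : 0 < ((2 * k : ℕ) : ℝ) * r ^ (2 * k - 1) := by push_cast; positivity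
      have h2 : 0 < (r ^ (2 * k)) ^ 2 := by positivity
      exact div_ne_zero (neg_ne_zero.2 this.ne') h2.ne')
    hlim hpow (by
      refine ((h.neg.div_const (2 * k : ℝ)).congr' ?_).trans_eq (by simp)
      filter_upwards [eventually_gt_atTop 0] with r hr
      have : r ^ (2 * k) = r ^ (2 * k - 1) * r := by rw [← pow_succ]; congr 1; omega
      rw [pow_succ, this]
      push_cast
      field_simp)
  refine key.congr' ?_
  filter_upwards [eventually_gt_atTop 0] with r hr
  simp only [Pi.inv_apply]
  field_simp

/-- Asymptotics of a radial solution of `(-Δ)^m v = f` with `f` integrable, under a Riccati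
inequality which excludes polynomial terms. -/
theorem tendsto_mul_deriv_of_radial_system {m : ℕ} (hm : 2 ≤ m) {v p : ℕ → ℝ → ℝ}
    (hvc : ∀ k, ∀ r, HasDerivAt (v k) (p k r) r) (hpc : ∀ k, Continuous (p k))
    (hp : ∀ k, ∀ r > 0,
      r ^ (2 * m - 1) * p k r = -∫ s in (0 : ℝ)..r, s ^ (2 * m - 1) * v (k + 1) s)
    {I : ℝ} (hI : Tendsto (fun r => ∫ s in (0 : ℝ)..r, s ^ (2 * m - 1) * v m s) atTop (𝓝 I))
    {c : ℝ} (hc : 0 < c) (hR : ∀ᶠ r in atTop, c * p 0 r ^ 2 ≤ v 1 r) :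
    Tendsto (fun r => r * p 0 r) atTop (𝓝 (-(I / (2 ^ (m - 1) * (m - 1).factorial) ^ 2))) := by
  have hcont (k : ℕ) : Continuous (v k) :=
    continuous_iff_continuousAt.2 fun r => (hvc k r).continuousAt
  -- Upward induction from `v 1`, which is eventually nonnegative and is kept from staying above `ε`
  -- by the Riccati inequality. If `v (k + 2)` stayed away from zero, `v (k + 1)` would diverge. The
  -- function `v 0` is left out because it may itself diverge.
  have hnot (k : ℕ) : ∀ ε > 0, ¬ (∀ᶠ r in atTop, ε ≤ v (k + 1) r) ∧
      ¬ ∀ᶠ r in atTop, v (k + 1) r ≤ -ε := by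
    induction k with
    | zero =>
      refine fun ε hε => ⟨not_eventually_ge_of_riccati (by omega) (hcont 1) (hp 0) hc hR hε, ?_⟩
      intro h
      obtain ⟨r, h1, h2⟩ := (h.and hR).exists
      have : 0 ≤ c * p 0 r ^ 2 := by positivity
      simp only [zero_add] at h1
      linarith
    | succ k ih =>
      refine fun ε hε => ⟨fun h => ?_, fun h => ?_⟩
      · exact (ih 1 one_pos).2 (eventually_le_neg_of_source_ge (by omega) (hcont _) (hvc (k + 1))
          (hp (k + 1)) hε h 1)
      · refine (ih 1 one_pos).1 ?_
        have := eventually_le_neg_of_source_ge (n := 2 * m) (by omega) (hcont (k + 1 + 1)).neg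
          (v := fun r => -v (k + 1) r) (p := fun r => -p (k + 1) r)
          (fun r => (hvc (k + 1) r).neg) (by
            intro r hr
            have := hp (k + 1) r hr
            simp only [Pi.neg_apply, mul_neg, intervalIntegral.integral_neg, this]) hε
          (by filter_upwards [h] with r hr; simp; linarith) 1
        filter_upwards [this] with r hr
        linarith
  -- Downward induction on the level `m - 1 - j`. The base case is the convergence to `I`. Passing
  -- from level `k + 1 = m - 1 - j` to `k` divides by `2(k+1)` when `p (k + 1)` is integrated, and
  -- by `2m - 2(k+1) = 2(j+1)` when the source is integrated.
  have main (j : ℕ) (hj : j + 1 ≤ m) :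
      Tendsto (fun r => r ^ (2 * (m - 1 - j) + 1) * p (m - 1 - j) r) atTop
        (𝓝 (-(I / ∏ i ∈ Finset.range j, ((2 * (m - 1 - i : ℕ) : ℝ) * (2 * (i + 1 : ℕ)))))) := by
    induction j with
    | zero =>
      simp only [Finset.range_zero, Finset.prod_empty, div_one, Nat.sub_zero]
      refine hI.neg.congr' ?_
      filter_upwards [eventually_gt_atTop 0] with r hr
      have := hp (m - 1) r hr
      rw [show m - 1 + 1 = m by omega] at this
      rw [← this]; congr 2; omega
    | succ j ih =>
      have h1 := ih (by omega)
      obtain ⟨k, hk⟩ : ∃ k, m - 1 - j = k + 1 := ⟨m - 1 - (j + 1), by omega⟩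
      have hk' : m - 1 - (j + 1) = k := by omega
      rw [hk']
      rw [hk] at h1
      have h2 := tendsto_pow_mul_of_deriv (by omega) (hvc (k + 1)) (hpc _) (hnot k) h1
      have h3 := tendsto_pow_mul_deriv_of_source (n := 2 * m) (by omega) (by omega) (hcont _)
        (hp k) h2
      rw [show 2 * (k + 1) - 1 = 2 * k + 1 by omega] at h3
      convert h3 using 3
      rw [Finset.prod_range_succ, hk, show 2 * m - 2 * (k + 1) = 2 * (j + 1) by omega]
      rw [div_div, div_div]
      push_cast
      ring
  have h0 := main (m - 1) (by omega)
  simp only [Nat.sub_self, mul_zero, zero_add, pow_one] at h0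
  convert h0 using 4
  have e1 : ∏ i ∈ Finset.range (m - 1), ((i + 1 : ℕ) : ℝ) = ((m - 1).factorial : ℝ) := by
    rw [← Finset.prod_range_add_one_eq_factorial]; push_cast; rfl
  have e2 : ∏ i ∈ Finset.range (m - 1), ((m - 1 - i : ℕ) : ℝ) = ((m - 1).factorial : ℝ) := by
    rw [← e1, ← Finset.prod_range_reflect]
    refine Finset.prod_congr rfl fun i hi => ?_
    rw [Finset.mem_range] at hi
    congr 1; omega
  rw [Finset.prod_mul_distrib, Finset.prod_mul_distrib, Finset.prod_mul_distrib, e1, e2]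
  simp
  ring

end RadialSystem

/-! ### Spherical means, polar coordinates, divergence theorem -/

/-- The integral of `v` over the unit sphere, after dilation by `r`. -/
noncomputable def sphereIntegral {n : ℕ} (v : Euc n → ℝ) (r : ℝ) : ℝ :=
  ∫ θ : Metric.sphere (0 : Euc n) 1, v (r • (θ : Euc n)) ∂(volume : Measure (Euc n)).toSphere

/-- The integral over the unit sphere of the radial derivative of `v` at radius `r`. -/
noncomputable def sphereFlux {n : ℕ} (v : Euc n → ℝ) (r : ℝ) : ℝ :=
  ∫ θ : Metric.sphere (0 : Euc n) 1, fderiv ℝ v (r • (θ : Euc n)) θ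
    ∂(volume : Measure (Euc n)).toSphere

section Polar
open Metric Set

theorem integral_volumeIoiPow (k : ℕ) (f : ℝ → ℝ) :
    ∫ r : Ioi (0 : ℝ), f r ∂(Measure.volumeIoiPow k) = ∫ r in Ioi (0 : ℝ), r ^ k * f r := by
  simp only [Measure.volumeIoiPow, ENNReal.ofReal]
  rw [integral_withDensity_eq_integral_smul,
    integral_subtype_comap measurableSet_Ioi fun a ↦ Real.toNNReal (a ^ k) • f a,
    setIntegral_congr_fun measurableSet_Ioi fun x hx ↦ ?_]
  · rw [NNReal.smul_def, Real.coe_toNNReal _ (pow_nonneg hx.out.le _), smul_eq_mul]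
  · exact (measurable_subtype_coe.pow_const _).real_toNNReal

theorem integrable_volumeIoiPow {k : ℕ} {f : ℝ → ℝ} :
    Integrable (fun r : Ioi (0 : ℝ) => f r) (Measure.volumeIoiPow k) ↔
      IntegrableOn (fun r => r ^ k * f r) (Ioi 0) := by
  rw [integrableOn_iff_comap_subtypeVal measurableSet_Ioi, Measure.volumeIoiPow,
    integrable_withDensity_iff_integrable_smul' (by fun_prop) (by simp)]
  refine integrable_congr (Filter.Eventually.of_forall ?_)
  rintro ⟨x, hx : 0 < x⟩
  simp [ENNReal.toReal_ofReal (pow_nonneg hx.le k)]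

theorem integrable_polar {n : ℕ} (hn : 1 ≤ n) {F : Euc n → ℝ} (hF : Integrable F) :
    Integrable (fun p : sphere (0 : Euc n) 1 × Ioi (0 : ℝ) => F ((p.2 : ℝ) • (p.1 : Euc n)))
      ((volume : Measure (Euc n)).toSphere.prod (Measure.volumeIoiPow (n - 1))) ∧
    ∫ x, F x = ∫ p : sphere (0 : Euc n) 1 × Ioi (0 : ℝ), F ((p.2 : ℝ) • (p.1 : Euc n))
      ∂((volume : Measure (Euc n)).toSphere.prod (Measure.volumeIoiPow (n - 1))) := by
  have : Nontrivial (Euc n) := by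
    have : Nonempty (Fin n) := ⟨⟨0, by omega⟩⟩
    infer_instance
  have hmp := (volume : Measure (Euc n)).measurePreserving_homeomorphUnitSphereProd
  rw [finrank_euclideanSpace_fin] at hmp
  have hcomp (x : ({0}ᶜ : Set (Euc n))) :
      F (((homeomorphUnitSphereProd (Euc n) x).2 : ℝ) •
        ((homeomorphUnitSphereProd (Euc n) x).1 : Euc n)) = F x := by
    have h0 : ‖(x : Euc n)‖ ≠ 0 := norm_ne_zero_iff.2 x.2
    simp [smul_smul, h0]
  constructor
  · rw [← hmp.integrable_comp_emb (Homeomorph.measurableEmbedding _)]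
    refine (integrable_congr (Filter.Eventually.of_forall hcomp)).2 ?_
    have := (integrableOn_iff_comap_subtypeVal (s := ({0}ᶜ : Set (Euc n))) (f := F)
      (μ := volume) (measurableSet_singleton _).compl).1 hF.integrableOn
    exact this
  · rw [← hmp.integral_comp (Homeomorph.measurableEmbedding _)]
    simp_rw [hcomp]
    rw [integral_subtype_comap (measurableSet_singleton _).compl F, restrict_compl_singleton]

/-- Integration in polar coordinates. -/
theorem integral_eq_integral_sphereIntegral {n : ℕ} (hn : 1 ≤ n) {F : Euc n → ℝ}
    (hF : Integrable F) : ∫ x, F x = ∫ r in Ioi (0 : ℝ), r ^ (n - 1) * sphereIntegral F r := by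
  obtain ⟨h1, h2⟩ := integrable_polar hn hF
  rw [h2, integral_prod_symm _ h1]
  exact integral_volumeIoiPow (n - 1) (sphereIntegral F)

theorem integrableOn_sphereIntegral {n : ℕ} (hn : 1 ≤ n) {F : Euc n → ℝ} (hF : Integrable F) :
    IntegrableOn (fun r => r ^ (n - 1) * sphereIntegral F r) (Ioi 0) :=
  integrable_volumeIoiPow.1 (integrable_polar hn hF).1.integral_prod_right

end Polar

section ParametricIntegral
open Set

/-- By compactness, constant multiples of the indicator of `K` dominate `F` and `F'` locally in `r`.
The set `K` is the whole sphere for spherical means and the closed unit ball for integrals against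
the averaging kernel. -/
theorem hasDerivAt_integral_of_continuous {X : Type*} [TopologicalSpace X] [MeasurableSpace X]
    [OpensMeasurableSpace X] {μ : Measure X} [IsFiniteMeasureOnCompacts μ] {F F' : ℝ → X → ℝ}
    (hF : Continuous (Function.uncurry F)) (hF' : Continuous (Function.uncurry F'))
    (hd : ∀ r x, HasDerivAt (fun r => F r x) (F' r x) r) {K : Set X} (hK : IsCompact K)
    (hKm : MeasurableSet K) (h0 : ∀ r, ∀ x ∉ K, F r x = 0) (h0' : ∀ r, ∀ x ∉ K, F' r x = 0)
    (r : ℝ) : HasDerivAt (fun r => ∫ x, F r x ∂μ) (∫ x, F' r x ∂μ) r := by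
  have hc (r : ℝ) : Continuous (F r) := hF.comp (by fun_prop : Continuous fun x => (r, x))
  have hc' (r : ℝ) : Continuous (F' r) := hF'.comp (by fun_prop : Continuous fun x => (r, x))
  have hb (G : ℝ → X → ℝ) (hG : Continuous (Function.uncurry G)) (hG0 : ∀ r, ∀ x ∉ K, G r x = 0) :
      ∃ M, ∀ s ∈ Metric.closedBall r 1, ∀ x, ‖G s x‖ ≤ K.indicator (fun _ => M) x := by
    obtain ⟨M, hM⟩ := ((isCompact_closedBall r 1).prod hK).exists_bound_of_continuousOn
      hG.continuousOn
    refine ⟨M, fun s hs x => ?_⟩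
    by_cases hx : x ∈ K
    · rw [indicator_of_mem hx]; exact hM (s, x) ⟨hs, hx⟩
    · rw [indicator_of_notMem hx, hG0 s x hx, norm_zero]
  have hi (M : ℝ) : Integrable (K.indicator fun _ => M) μ :=
    (integrable_indicator_iff hKm).2 (integrableOn_const hK.measure_lt_top.ne)
  obtain ⟨M, hM⟩ := hb F hF h0
  obtain ⟨M', hM'⟩ := hb F' hF' h0'
  exact (hasDerivAt_integral_of_dominated_loc_of_deriv_le (bound := K.indicator fun _ => M')
    (Metric.closedBall_mem_nhds r one_pos)
    (Filter.Eventually.of_forall fun s => (hc s).aestronglyMeasurable)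
    ((hi M).mono' (hc r).aestronglyMeasurable (Filter.Eventually.of_forall
      (hM r (Metric.mem_closedBall_self zero_le_one))))
    (hc' r).aestronglyMeasurable (Filter.Eventually.of_forall fun x s hs => hM' s hs x) (hi M')
    (Filter.Eventually.of_forall fun x s _ => hd s x)).2

end ParametricIntegral

theorem continuous_sphereIntegral {n : ℕ} {v : Euc n → ℝ} (hv : Continuous v) :
    Continuous (sphereIntegral v) := by
  have := continuous_parametric_integral_of_continuous
    (μ := (volume : Measure (Euc n)).toSphere)
    (f := fun (r : ℝ) (θ : Metric.sphere (0 : Euc n) 1) => v (r • (θ : Euc n)))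
    (by unfold Function.uncurry; fun_prop) isCompact_univ
  simp only [Measure.restrict_univ] at this
  exact this

theorem continuous_sphereFlux {n : ℕ} {v : Euc n → ℝ} (hv : ContDiff ℝ ∞ v) :
    Continuous (sphereFlux v) := by
  have hf := continuous_fderiv_of_contDiff hv
  have := continuous_parametric_integral_of_continuous
    (μ := (volume : Measure (Euc n)).toSphere)
    (f := fun (r : ℝ) (θ : Metric.sphere (0 : Euc n) 1) => fderiv ℝ v (r • (θ : Euc n)) θ)
    (by unfold Function.uncurry; fun_prop) isCompact_univ
  simp only [Measure.restrict_univ] at this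
  exact this

theorem hasDerivAt_sphereIntegral {n : ℕ} {v : Euc n → ℝ} (hv : ContDiff ℝ ∞ v) (r : ℝ) :
    HasDerivAt (sphereIntegral v) (sphereFlux v r) r := by
  have hf := continuous_fderiv_of_contDiff hv
  have hvc := hv.continuous
  refine hasDerivAt_integral_of_continuous
    (F := fun (r : ℝ) (θ : Metric.sphere (0 : Euc n) 1) => v (r • (θ : Euc n)))
    (F' := fun (r : ℝ) (θ : Metric.sphere (0 : Euc n) 1) => fderiv ℝ v (r • (θ : Euc n)) θ)
    (by unfold Function.uncurry; fun_prop) (by unfold Function.uncurry; fun_prop) (fun r θ => ?_)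
    isCompact_univ MeasurableSet.univ (by simp) (by simp) r
  have h1 : HasDerivAt (fun r : ℝ => r • (θ : Euc n)) (θ : Euc n) r := by
    simpa using (hasDerivAt_id r).smul_const (θ : Euc n)
  exact ((hv.differentiable (by simp)) (r • (θ : Euc n))).hasFDerivAt.comp_hasDerivAt r h1

theorem mul_sphereFlux {n : ℕ} (v : Euc n → ℝ) (r : ℝ) :
    r * sphereFlux v r = sphereIntegral (fun x => fderiv ℝ v x x) r := by
  unfold sphereFlux sphereIntegral
  rw [← integral_const_mul]
  simp

theorem sphereIntegral_radial_mul {n : ℕ} (G : ℝ → ℝ) (v : Euc n → ℝ) (r : ℝ) :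
    sphereIntegral (fun x => G (‖x‖ ^ 2) * v x) r = G (r ^ 2) * sphereIntegral v r := by
  unfold sphereIntegral
  rw [← integral_const_mul]
  refine integral_congr_ae (Filter.Eventually.of_forall fun θ => ?_)
  simp [norm_smul]

theorem setIntegral_Ioi_eq_intervalIntegral {f : ℝ → ℝ} {b : ℝ} (hb : 0 ≤ b)
    (h : ∀ s, b ≤ s → f s = 0) : ∫ s in Set.Ioi (0 : ℝ), f s = ∫ s in (0 : ℝ)..b, f s := by
  rw [intervalIntegral.integral_of_le hb]
  refine setIntegral_eq_of_subset_of_forall_sdiff_eq_zero measurableSet_Ioi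
    Set.Ioc_subset_Ioi_self fun s hs => h s ?_
  simp only [Set.mem_sdiff, Set.mem_Ioi, Set.mem_Ioc, not_and, not_le] at hs
  exact (hs.2 hs.1).le

/-- A weak form of the divergence theorem on balls, free of boundary integrals. Green's identity
against `Θ(|x|²)` is written in polar coordinates and integrated by parts in the radius. -/
theorem integral_deriv_mul_flux_defect {n : ℕ} (hn : 1 ≤ n) {v : Euc n → ℝ} (hv : ContDiff ℝ ∞ v)
    {Θ : ℝ → ℝ} (hΘ : ContDiff ℝ 1 Θ) {b : ℝ} (hb : 0 < b) (hB : ∀ t, b ^ 2 ≤ t → Θ t = 0) :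
    ∫ s in (0 : ℝ)..b, 2 * s * deriv Θ (s ^ 2) *
      ((∫ t in (0 : ℝ)..s, t ^ (n - 1) * sphereIntegral (Δ v) t) - s ^ (n - 1) * sphereFlux v s)
      = 0 := by
  have hΔ := (contDiff_laplacian hv).continuous
  have hS := continuous_sphereIntegral hΔ
  have hfl := continuous_sphereFlux hv
  have hfd := continuous_fderiv_of_contDiff hv
  have hΘ' : Continuous (deriv Θ) := hΘ.continuous_deriv (by simp)
  -- At the endpoint `t = b²`, where `Θ` is known to vanish on one side only, continuity of `Θ'` is
  -- used.
  have hB' (t : ℝ) (ht : b ^ 2 ≤ t) : deriv Θ t = 0 := by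
    have h1 : Set.EqOn (deriv Θ) 0 (Set.Ioi (b ^ 2)) := fun s hs => by
      have : Θ =ᶠ[nhds s] fun _ => 0 := by
        filter_upwards [lt_mem_nhds hs] with y hy using hB y hy.le
      rw [this.deriv_eq]; simp
    have h2 := h1.closure hΘ' continuous_const
    rw [closure_Ioi] at h2
    exact h2 ht
  have hG := integral_radial_mul_laplacian hΘ hB hv
  have hi1 : Integrable fun x => Θ (‖x‖ ^ 2) * Δ v x :=
    ((hΘ.continuous.comp (continuous_norm.pow 2)).mul hΔ).integrable_of_hasCompactSupport
      (hasCompactSupport_comp_norm_sq hB).mul_right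
  have hi2 : Integrable fun x => 2 * deriv Θ (‖x‖ ^ 2) * fderiv ℝ v x x :=
    ((continuous_const.mul (hΘ'.comp (continuous_norm.pow 2))).mul
      (hfd.clm_apply continuous_id)).integrable_of_hasCompactSupport
      (hasCompactSupport_comp_norm_sq (Θ := fun t => 2 * deriv Θ t) (B := b ^ 2)
        (by intro t ht; simp [hB' t ht])).mul_right
  rw [integral_eq_integral_sphereIntegral hn hi1, integral_eq_integral_sphereIntegral hn hi2] at hG
  simp_rw [sphereIntegral_radial_mul Θ (Δ v),
    sphereIntegral_radial_mul (fun t => 2 * deriv Θ t), ← mul_sphereFlux] at hG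
  rw [setIntegral_Ioi_eq_intervalIntegral hb.le
      (fun s hs => by rw [hB _ (pow_le_pow_left₀ hb.le hs 2)]; ring),
    setIntegral_Ioi_eq_intervalIntegral hb.le
      (fun s hs => by rw [hB' _ (pow_le_pow_left₀ hb.le hs 2)]; ring)] at hG
  have hcD : Continuous fun t : ℝ => t ^ (n - 1) * sphereIntegral (Δ v) t := by fun_prop
  have hE (s : ℝ) : HasDerivAt (fun s => ∫ t in (0 : ℝ)..s, t ^ (n - 1) * sphereIntegral (Δ v) t)
      (s ^ (n - 1) * sphereIntegral (Δ v) s) s :=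
    intervalIntegral.integral_hasDerivAt_right (hcD.intervalIntegrable _ _)
      (hcD.stronglyMeasurableAtFilter _ _) hcD.continuousAt
  have hEc : Continuous fun s => ∫ t in (0 : ℝ)..s, t ^ (n - 1) * sphereIntegral (Δ v) t :=
    continuous_iff_continuousAt.2 fun s => (hE s).continuousAt
  have hT (s : ℝ) : HasDerivAt (fun s => Θ (s ^ 2)) (2 * s * deriv Θ (s ^ 2)) s := by
    have := ((hΘ.differentiable (by simp)) (s ^ 2)).hasDerivAt.comp s (hasDerivAt_pow 2 s)
    refine this.congr_deriv ?_
    push_cast; ring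
  have hibp := intervalIntegral.integral_mul_deriv_eq_deriv_mul (a := 0) (b := b)
    (fun s _ => hT s) (fun s _ => hE s)
    ((by fun_prop : Continuous fun s : ℝ => 2 * s * deriv Θ (s ^ 2)).intervalIntegrable _ _)
    (hcD.intervalIntegrable _ _)
  simp only [hB (b ^ 2) le_rfl, intervalIntegral.integral_same, zero_mul, mul_zero,
    zero_sub, sub_zero] at hibp
  simp_rw [mul_sub]
  rw [intervalIntegral.integral_sub
    ((by fun_prop : Continuous fun s : ℝ => 2 * s * deriv Θ (s ^ 2) *
      ∫ t in (0 : ℝ)..s, t ^ (n - 1) * sphereIntegral (Δ v) t).intervalIntegrable _ _)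
    ((by fun_prop : Continuous fun s : ℝ => 2 * s * deriv Θ (s ^ 2) *
      (s ^ (n - 1) * sphereFlux v s)).intervalIntegrable _ _)]
  have e1 : ∫ s in (0 : ℝ)..b, s ^ (n - 1) * (Θ (s ^ 2) * sphereIntegral (Δ v) s) =
      ∫ s in (0 : ℝ)..b, Θ (s ^ 2) * (s ^ (n - 1) * sphereIntegral (Δ v) s) := by
    congr 1; funext s; ring
  have e2 : ∫ s in (0 : ℝ)..b, s ^ (n - 1) * (2 * deriv Θ (s ^ 2) * (s * sphereFlux v s)) =
      ∫ s in (0 : ℝ)..b, 2 * s * deriv Θ (s ^ 2) * (s ^ (n - 1) * sphereFlux v s) := by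
    congr 1; funext s; ring
  rw [e1, e2] at hG
  linarith

/-- The divergence theorem for the gradient of `v` on a ball centred at the origin. -/
theorem pow_mul_sphereFlux {n : ℕ} (hn : 1 ≤ n) {v : Euc n → ℝ} (hv : ContDiff ℝ ∞ v) {r : ℝ}
    (hr : 0 < r) : r ^ (n - 1) * sphereFlux v r =
      ∫ s in (0 : ℝ)..r, s ^ (n - 1) * sphereIntegral (Δ v) s := by
  set h : ℝ → ℝ := fun s =>
    (∫ t in (0 : ℝ)..s, t ^ (n - 1) * sphereIntegral (Δ v) t) - s ^ (n - 1) * sphereFlux v s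
    with hh
  have hS := continuous_sphereIntegral (contDiff_laplacian hv).continuous
  have hfl := continuous_sphereFlux hv
  have hcD : Continuous fun t : ℝ => t ^ (n - 1) * sphereIntegral (Δ v) t := by fun_prop
  have hc : Continuous h :=
    (intervalIntegral.continuous_primitive (fun a b => hcD.intervalIntegrable a b) 0).sub
      (by fun_prop)
  suffices h r = 0 by simp only [hh] at this; linarith
  by_contra hne
  have hε : 0 < |h r| / 2 := by positivity
  obtain ⟨δ, hδ, hclose⟩ := Metric.continuous_iff.1 hc r _ hε
  set b := r + δ / 2 with hb
  have hrb : r < b := by linarith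
  have hd : 0 < b ^ 2 - r ^ 2 := by nlinarith
  -- The weight `-2sΘ'(s²)` has integral one over `[0, b]` and vanishes for `s < r`, and `h`
  -- averages to zero against it. But `h` stays within `|h r|/2` of `h r` on `[r, b]`, so `h r` must
  -- be zero.
  set Θ : ℝ → ℝ := fun t => Real.smoothTransition ((b ^ 2 - t) / (b ^ 2 - r ^ 2)) with hΘdef
  have hΘ : ContDiff ℝ 1 Θ := Real.smoothTransition.contDiff.comp (by fun_prop)
  have hΘ' : Continuous (deriv Θ) := hΘ.continuous_deriv (by simp)
  have hzero (t : ℝ) (ht : b ^ 2 ≤ t) : Θ t = 0 :=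
    Real.smoothTransition.zero_of_nonpos (div_nonpos_of_nonpos_of_nonneg (by linarith) hd.le)
  have hone (t : ℝ) (ht : t ≤ r ^ 2) : Θ t = 1 :=
    Real.smoothTransition.one_of_one_le ((one_le_div hd).2 (by linarith))
  have hanti : Antitone Θ := fun s t hst => Real.smoothTransition.monotone (by gcongr)
  have hneg (t : ℝ) : deriv Θ t ≤ 0 := hanti.deriv_nonpos
  have hone' (t : ℝ) (ht : t < r ^ 2) : deriv Θ t = 0 := by
    have : Θ =ᶠ[nhds t] fun _ => 1 := by
      filter_upwards [gt_mem_nhds ht] with y hy using hone y hy.le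
    rw [this.deriv_eq]; simp
  have hT (s : ℝ) : HasDerivAt (fun s => Θ (s ^ 2)) (2 * s * deriv Θ (s ^ 2)) s := by
    have := ((hΘ.differentiable (by simp)) (s ^ 2)).hasDerivAt.comp s (hasDerivAt_pow 2 s)
    refine this.congr_deriv ?_
    push_cast; ring
  have hcw : Continuous fun s : ℝ => 2 * s * deriv Θ (s ^ 2) := by fun_prop
  have hint : ∫ s in (0 : ℝ)..b, 2 * s * deriv Θ (s ^ 2) = -1 := by
    rw [intervalIntegral.integral_eq_sub_of_hasDerivAt (fun s _ => hT s)
      (hcw.intervalIntegrable _ _), hzero _ le_rfl, hone _ (by simpa using sq_nonneg r)]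
    norm_num
  have h0 := integral_deriv_mul_flux_defect hn hv hΘ (by linarith : 0 < b) hzero
  change ∫ s in (0 : ℝ)..b, 2 * s * deriv Θ (s ^ 2) * h s = 0 at h0
  have h1 : h r = ∫ s in (0 : ℝ)..b, 2 * s * deriv Θ (s ^ 2) * (h s - h r) := by
    simp_rw [mul_sub]
    rw [intervalIntegral.integral_sub
      ((by fun_prop : Continuous fun s => 2 * s * deriv Θ (s ^ 2) * h s).intervalIntegrable _ _)
      ((by fun_prop : Continuous fun s => 2 * s * deriv Θ (s ^ 2) * h r).intervalIntegrable _ _),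
      h0,
      intervalIntegral.integral_mul_const, hint]
    ring
  have h2 : |h r| ≤ ∫ s in (0 : ℝ)..b, -(2 * s * deriv Θ (s ^ 2)) * (|h r| / 2) := by
    conv_lhs => rw [h1, ← Real.norm_eq_abs]
    refine intervalIntegral.norm_integral_le_of_norm_le (by linarith)
      (Filter.Eventually.of_forall fun s hs => ?_)
      ((hcw.neg.mul continuous_const).intervalIntegrable _ _)
    have hw : 0 ≤ -(2 * s * deriv Θ (s ^ 2)) := by
      have := hneg (s ^ 2); have := hs.1; nlinarith
    rw [norm_mul, Real.norm_eq_abs, abs_of_nonpos (by linarith)]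
    by_cases hsr : s < r
    · rw [hone' _ (by nlinarith [hs.1])]; simp
    · refine mul_le_mul_of_nonneg_left ?_ hw
      have := hclose s (by rw [Real.dist_eq, abs_of_nonneg (by linarith)]; linarith [hs.2])
      exact this.le
  rw [intervalIntegral.integral_mul_const, intervalIntegral.integral_neg, hint] at h2
  linarith

/-! ### Averaging kernel, mean value inequality, Caccioppoli's inequality -/

/-- The derivative `-2 Ψ'` of the cutoff profile `Ψ(t) = smoothTransition (1 - t)`. -/
noncomputable def kernelProfile (t : ℝ) : ℝ :=
  -2 * deriv (fun t => Real.smoothTransition (1 - t)) t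

/-- A radial kernel supported in the unit ball, with respect to which superharmonic functions
satisfy the mean value inequality. -/
noncomputable def averagingKernel {n : ℕ} (y : Euc n) : ℝ := kernelProfile (‖y‖ ^ 2)

/-- A radial cutoff function equal to one on the unit ball. -/
noncomputable def unitBallCutoff {n : ℕ} (y : Euc n) : ℝ := Real.smoothTransition (2 - ‖y‖ ^ 2)

theorem contDiff_smoothTransition_const_sub (a : ℝ) :
    ContDiff ℝ ∞ fun t : ℝ => Real.smoothTransition (a - t) :=
  Real.smoothTransition.contDiff.comp (by fun_prop)

theorem kernelProfile_nonneg (t : ℝ) : 0 ≤ kernelProfile t := by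
  have : Antitone fun t => Real.smoothTransition (1 - t) :=
    fun s t hst => Real.smoothTransition.monotone (by linarith)
  have := this.deriv_nonpos (x := t)
  unfold kernelProfile
  linarith

theorem continuous_kernelProfile : Continuous kernelProfile :=
  continuous_const.mul ((contDiff_smoothTransition_const_sub 1).continuous_deriv (by simp))

theorem kernelProfile_eq_zero {t : ℝ} (ht : 1 ≤ t) : kernelProfile t = 0 := by
  have h1 : Set.EqOn kernelProfile 0 (Set.Ioi 1) := fun s hs => by
    have : (fun t => Real.smoothTransition (1 - t)) =ᶠ[nhds s] fun _ => 0 := by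
      filter_upwards [lt_mem_nhds hs] with y hy
      exact Real.smoothTransition.zero_of_nonpos (by linarith)
    unfold kernelProfile
    rw [this.deriv_eq]; simp
  have h2 := h1.closure continuous_kernelProfile continuous_const
  rw [closure_Ioi] at h2
  exact h2 ht

theorem averagingKernel_nonneg {n : ℕ} (y : Euc n) : 0 ≤ averagingKernel y :=
  kernelProfile_nonneg _

theorem continuous_averagingKernel {n : ℕ} : Continuous (averagingKernel (n := n)) :=
  continuous_kernelProfile.comp (by fun_prop)

theorem averagingKernel_eq_zero {n : ℕ} {y : Euc n} (hy : 1 ≤ ‖y‖) : averagingKernel y = 0 :=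
  kernelProfile_eq_zero (one_le_pow₀ hy)

theorem hasCompactSupport_averagingKernel {n : ℕ} :
    HasCompactSupport (averagingKernel (n := n)) :=
  hasCompactSupport_comp_norm_sq fun _ ht => kernelProfile_eq_zero ht

theorem integrable_mul_averagingKernel {n : ℕ} {f : Euc n → ℝ} (hf : Continuous f) :
    Integrable fun y => f y * averagingKernel y :=
  (hf.mul continuous_averagingKernel).integrable_of_hasCompactSupport
    hasCompactSupport_averagingKernel.mul_left

theorem integrable_averagingKernel {n : ℕ} : Integrable (averagingKernel (n := n)) :=
  continuous_averagingKernel.integrable_of_hasCompactSupport hasCompactSupport_averagingKernel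

theorem integral_averagingKernel_pos {n : ℕ} (hn : 1 ≤ n) :
    0 < ∫ y : Euc n, averagingKernel y := by
  -- The profile falls from `1` to `0` on `[0, 1]`, so its slope is `-1` at some `t`; the kernel
  -- equals `2` where `|y|² = t`.
  obtain ⟨t, ht, hd⟩ := exists_deriv_eq_slope (fun t => Real.smoothTransition (1 - t))
    zero_lt_one ((contDiff_smoothTransition_const_sub 1).continuous.continuousOn)
    ((contDiff_smoothTransition_const_sub 1).differentiable (by simp)).differentiableOn
  refine continuous_averagingKernel.integral_pos_of_hasCompactSupport_nonneg_nonzero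
    hasCompactSupport_averagingKernel averagingKernel_nonneg
    (x := √t • EuclideanSpace.single ⟨0, by omega⟩ 1) ?_
  rw [averagingKernel, norm_smul, PiLp.norm_single, norm_one, mul_one, Real.norm_eq_abs,
    sq_abs, Real.sq_sqrt ht.1.le, kernelProfile, hd]
  norm_num

/-- The mean value inequality for superharmonic functions. -/
theorem integral_mul_averagingKernel_le {n : ℕ} {v : Euc n → ℝ} (hv : ContDiff ℝ ∞ v)
    (h : ∀ y, ‖y‖ ≤ 1 → Δ v y ≤ 0) :
    ∫ y, v y * averagingKernel y ≤ v 0 * ∫ y : Euc n, averagingKernel y := by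
  have hvd := hv.differentiable (by simp)
  have hf := continuous_fderiv_of_contDiff hv
  have hvc := hv.continuous
  have hk := continuous_averagingKernel (n := n)
  have hM (r : ℝ) : HasDerivAt (fun r : ℝ => ∫ y : Euc n, v (r • y) * averagingKernel y)
      (∫ y : Euc n, fderiv ℝ v (r • y) y * averagingKernel y) r := by
    refine hasDerivAt_integral_of_continuous
      (F := fun (r : ℝ) (y : Euc n) => v (r • y) * averagingKernel y)
      (F' := fun (r : ℝ) (y : Euc n) => fderiv ℝ v (r • y) y * averagingKernel y)
      (by unfold Function.uncurry; fun_prop) (by unfold Function.uncurry; fun_prop)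
      (fun r y => ?_) (isCompact_closedBall (0 : Euc n) 1) measurableSet_closedBall
      (fun r y hy => ?_) (fun r y hy => ?_) r
    · have h1 : HasDerivAt (fun r : ℝ => r • y) y r := by
        simpa using (hasDerivAt_id r).smul_const y
      exact ((hvd (r • y)).hasFDerivAt.comp_hasDerivAt r h1).mul_const _
    all_goals
      rw [mem_closedBall_zero_iff, not_le] at hy
      rw [averagingKernel_eq_zero hy.le, mul_zero]
  -- Let `M(r)` be the integral of `v(ry)` against the kernel. Green's identity for `y ↦ v(ry)`
  -- shows that `r M'(r)` is the integral of its Laplacian against the cutoff `Ψ(|y|²)`, hence `M' ≤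
  -- 0`. The claim is `M(1) ≤ M(0)`.
  have hneg (r : ℝ) (hr : r ∈ Set.Ioo (0 : ℝ) 1) :
      ∫ y : Euc n, fderiv ℝ v (r • y) y * averagingKernel y ≤ 0 := by
    have hvr : ContDiff ℝ ∞ fun y : Euc n => v (0 + r • y) := by fun_prop
    have hg := integral_radial_mul_laplacian (Θ := fun t => Real.smoothTransition (1 - t)) (B := 1)
      ((contDiff_smoothTransition_const_sub 1).of_le (by simp))
      (fun t ht => Real.smoothTransition.zero_of_nonpos (by linarith)) hvr
    have h1 : ∫ y : Euc n, Real.smoothTransition (1 - ‖y‖ ^ 2) *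
        Δ (fun y : Euc n => v (0 + r • y)) y ≤ 0 := by
      refine integral_nonpos fun y => ?_
      rw [laplacian_comp_affine hv]
      by_cases hy : ‖y‖ ≤ 1
      · refine mul_nonpos_of_nonneg_of_nonpos (Real.smoothTransition.nonneg _)
          (mul_nonpos_of_nonneg_of_nonpos (sq_nonneg r) (h _ ?_))
        rw [zero_add, norm_smul, Real.norm_of_nonneg hr.1.le]
        exact mul_le_one₀ hr.2.le (norm_nonneg _) hy
      · rw [Real.smoothTransition.zero_of_nonpos (by nlinarith)]
        simp
    have h2 : -∫ y : Euc n, 2 * deriv (fun t => Real.smoothTransition (1 - t)) (‖y‖ ^ 2) *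
        fderiv ℝ (fun y : Euc n => v (0 + r • y)) y y =
        r * ∫ y : Euc n, fderiv ℝ v (r • y) y * averagingKernel y := by
      rw [← integral_neg, ← integral_const_mul]
      congr 1
      funext y
      rw [fderiv_comp_affine hvd, averagingKernel, kernelProfile]
      simp
      ring
    rw [hg, h2] at h1
    exact nonpos_of_mul_nonpos_right h1 hr.1
  have hanti : AntitoneOn (fun r : ℝ => ∫ y : Euc n, v (r • y) * averagingKernel y)
      (Set.Icc 0 1) := by
    refine antitoneOn_of_deriv_nonpos (convex_Icc 0 1)
      (fun r _ => (hM r).continuousAt.continuousWithinAt)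
      (fun r _ => (hM r).differentiableAt.differentiableWithinAt) fun r hr => ?_
    rw [interior_Icc] at hr
    rw [(hM r).deriv]
    exact hneg r hr
  have := hanti (Set.left_mem_Icc.2 zero_le_one) (Set.right_mem_Icc.2 zero_le_one) zero_le_one
  simpa [integral_const_mul] using this

theorem contDiff_unitBallCutoff {n : ℕ} : ContDiff ℝ ∞ (unitBallCutoff (n := n)) :=
  (contDiff_smoothTransition_const_sub 2).comp (contDiff_norm_sq ℝ)

theorem hasCompactSupport_unitBallCutoff {n : ℕ} : HasCompactSupport (unitBallCutoff (n := n)) :=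
  hasCompactSupport_comp_norm_sq (Θ := fun t => Real.smoothTransition (2 - t)) (B := 2)
    fun t ht => Real.smoothTransition.zero_of_nonpos (by linarith)

/-- Caccioppoli's inequality for `Δ v + c |∇v|² ≤ 0`. -/
theorem integral_cutoff_mul_norm_fderiv_sq_le {n : ℕ} {v : Euc n → ℝ} (hv : ContDiff ℝ ∞ v)
    {c : ℝ} (hc : 0 < c) (h : ∀ y, ‖y‖ ≤ 2 → c * ‖fderiv ℝ v y‖ ^ 2 ≤ -Δ v y) :
    ∫ y, unitBallCutoff y ^ 2 * ‖fderiv ℝ v y‖ ^ 2 ≤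
      4 / c ^ 2 * ∫ y : Euc n, ‖fderiv ℝ (unitBallCutoff (n := n)) y‖ ^ 2 := by
  set η : Euc n → ℝ := unitBallCutoff with hη
  have hηs : ContDiff ℝ ∞ η := contDiff_unitBallCutoff
  have hηc : HasCompactSupport η := hasCompactSupport_unitBallCutoff
  have hηk := hηs.continuous
  have hf := continuous_fderiv_of_contDiff hv
  have hfη := continuous_fderiv_of_contDiff hηs
  have hη2 : HasCompactSupport fun y => η y ^ 2 := by
    simp_rw [sq]; exact hηc.mul_right
  have hL := (contDiff_laplacian hv).continuous
  have i1 : Integrable fun y => η y ^ 2 * ‖fderiv ℝ v y‖ ^ 2 :=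
    (by fun_prop : Continuous _).integrable_of_hasCompactSupport hη2.mul_right
  have i2 : Integrable fun y => η y ^ 2 * Δ v y :=
    (by fun_prop : Continuous _).integrable_of_hasCompactSupport hη2.mul_right
  have i3 : Integrable fun y => ‖fderiv ℝ η y‖ ^ 2 := by
    refine (by fun_prop : Continuous _).integrable_of_hasCompactSupport ?_
    exact (hηc.fderiv (𝕜 := ℝ)).comp_left (g := fun L => ‖L‖ ^ 2) (by simp)
  have hg := integral_mul_laplacian (χ := fun y => η y ^ 2) ((hηs.pow 2).of_le (by simp)) hη2 hv
  have hpd (i : Fin n) (y : Euc n) :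
      partialDeriv i (fun y => η y ^ 2) y = 2 * η y * partialDeriv i η y := by
    unfold partialDeriv
    rw [fderiv_fun_pow 2 ((hηs.differentiable (by simp)) y)]
    simp
  -- Young's inequality is weighted so that half of `c η²|∇v|²` is left to absorb the gradient. No
  -- bound on `v` is needed, because the quadratic gradient term is already part of the differential
  -- inequality.
  have hle : ∫ y, ∑ i, partialDeriv i (fun y => η y ^ 2) y * partialDeriv i v y ≤
      ∫ y, (c / 2 * (η y ^ 2 * ‖fderiv ℝ v y‖ ^ 2) + 2 / c * ‖fderiv ℝ η y‖ ^ 2) := by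
    refine integral_mono ?_ ((i1.const_mul _).add (i3.const_mul _)) fun y => ?_
    · refine integrable_finsetSum _ fun i _ => ?_
      have c1 := (partialDeriv_contDiff hv i).continuous
      have c2 := (partialDeriv_contDiff (hηs.pow 2) i).continuous
      exact (c2.mul c1).integrable_of_hasCompactSupport
        (hη2.fderiv_apply (𝕜 := ℝ) (EuclideanSpace.single i 1)).mul_right
    · simp only [norm_fderiv_sq_eq_sum, Finset.mul_sum]
      rw [← Finset.sum_add_distrib]
      refine Finset.sum_le_sum fun i _ => ?_
      rw [hpd]
      have : c / 2 * (η y ^ 2 * partialDeriv i v y ^ 2) + 2 / c * partialDeriv i η y ^ 2 -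
          2 * η y * partialDeriv i η y * partialDeriv i v y =
          (c * η y * partialDeriv i v y - 2 * partialDeriv i η y) ^ 2 / (2 * c) := by
        field_simp; ring
      have h2 : 0 ≤ (c * η y * partialDeriv i v y - 2 * partialDeriv i η y) ^ 2 / (2 * c) := by
        positivity
      linarith
  have hge : c * ∫ y, η y ^ 2 * ‖fderiv ℝ v y‖ ^ 2 ≤ -∫ y, η y ^ 2 * Δ v y := by
    rw [← integral_const_mul, ← integral_neg]
    refine integral_mono (i1.const_mul c) i2.neg fun y => ?_
    by_cases hy : ‖y‖ ≤ 2
    · have := mul_le_mul_of_nonneg_left (h y hy) (sq_nonneg (η y))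
      simp only
      linarith
    · have h0 : η y = 0 := Real.smoothTransition.zero_of_nonpos (by nlinarith)
      simp [h0]
  rw [integral_add (i1.const_mul _) (i3.const_mul _), integral_const_mul, integral_const_mul] at hle
  rw [hg, neg_neg] at hge
  have h3 : c / 2 * ∫ y, η y ^ 2 * ‖fderiv ℝ v y‖ ^ 2 ≤ 2 / c * ∫ y, ‖fderiv ℝ η y‖ ^ 2 := by
    linarith
  calc ∫ y, η y ^ 2 * ‖fderiv ℝ v y‖ ^ 2
      = 2 / c * (c / 2 * ∫ y, η y ^ 2 * ‖fderiv ℝ v y‖ ^ 2) := by field_simp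
    _ ≤ 2 / c * (2 / c * ∫ y, ‖fderiv ℝ η y‖ ^ 2) := by gcongr
    _ = _ := by ring

/-- A bound for the averaged gradient which depends only on `n` and `c`. -/
theorem exists_integral_norm_fderiv_le (n : ℕ) {c : ℝ} (hc : 0 < c) :
    ∃ C, 0 ≤ C ∧ ∀ v : Euc n → ℝ, ContDiff ℝ ∞ v →
      (∀ y, ‖y‖ ≤ 2 → c * ‖fderiv ℝ v y‖ ^ 2 ≤ -Δ v y) →
      ∫ y, ‖fderiv ℝ v y‖ * averagingKernel y ≤ C := by
  obtain ⟨B, hB⟩ := hasCompactSupport_averagingKernel (n := n).exists_bound_of_continuous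
    continuous_averagingKernel
  have hB0 : 0 ≤ B := (norm_nonneg _).trans (hB 0)
  -- On the unit ball the cutoff is one, so `t ≤ 1 + t²` and the bound `B` for the kernel reduce the
  -- claim to Caccioppoli's inequality.
  refine ⟨(∫ y : Euc n, averagingKernel y) +
    B * (4 / c ^ 2 * ∫ y : Euc n, ‖fderiv ℝ (unitBallCutoff (n := n)) y‖ ^ 2), ?_, ?_⟩
  · have h1 : 0 ≤ ∫ y : Euc n, averagingKernel y := integral_nonneg averagingKernel_nonneg
    have h2 : 0 ≤ ∫ y : Euc n, ‖fderiv ℝ (unitBallCutoff (n := n)) y‖ ^ 2 :=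
      integral_nonneg fun y => by positivity
    positivity
  intro v hv h
  have hf := continuous_fderiv_of_contDiff hv
  have hηk : Continuous (unitBallCutoff (n := n)) := contDiff_unitBallCutoff.continuous
  have hη2 : HasCompactSupport fun y : Euc n => unitBallCutoff y ^ 2 := by
    simp_rw [sq]; exact hasCompactSupport_unitBallCutoff.mul_right
  have i1 : Integrable fun y => unitBallCutoff y ^ 2 * ‖fderiv ℝ v y‖ ^ 2 :=
    (by fun_prop : Continuous _).integrable_of_hasCompactSupport hη2.mul_right
  refine le_trans ?_ (add_le_add_right (mul_le_mul_of_nonneg_left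
    (integral_cutoff_mul_norm_fderiv_sq_le hv hc h) hB0) _)
  rw [← integral_const_mul, ← integral_add integrable_averagingKernel (i1.const_mul B)]
  refine integral_mono (integrable_mul_averagingKernel hf.norm)
    (integrable_averagingKernel.add (i1.const_mul B)) fun y => ?_
  have hk := averagingKernel_nonneg y
  simp only
  by_cases hy : ‖y‖ ≤ 1
  · have h1 : unitBallCutoff y = 1 :=
      Real.smoothTransition.one_of_one_le (by nlinarith [norm_nonneg y])
    have h2 : averagingKernel y ≤ B := (le_abs_self _).trans (hB y)
    rw [h1]
    have h3 : ‖fderiv ℝ v y‖ ≤ 1 + ‖fderiv ℝ v y‖ ^ 2 := by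
      nlinarith [sq_nonneg (‖fderiv ℝ v y‖ - 1)]
    have h4 := mul_le_mul_of_nonneg_right h3 hk
    have h5 := mul_le_mul_of_nonneg_right h2 (sq_nonneg ‖fderiv ℝ v y‖)
    linarith
  · rw [averagingKernel_eq_zero (not_le.1 hy).le]
    have : 0 ≤ B * (unitBallCutoff y ^ 2 * ‖fderiv ℝ v y‖ ^ 2) := by positivity
    linarith

/-! ### Rotational invariance and spherical means of ball averages -/

theorem toSphere_real_univ_pos {n : ℕ} (hn : 1 ≤ n) :
    0 < (volume : Measure (Euc n)).toSphere.real Set.univ := by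
  have : Nonempty (Fin n) := ⟨⟨0, by omega⟩⟩
  have : Nontrivial (Euc n) := inferInstance
  rw [Measure.real, ENNReal.toReal_pos_iff]
  refine ⟨pos_iff_ne_zero.2 ?_, measure_lt_top _ _⟩
  rw [Ne, Measure.measure_univ_eq_zero]
  exact Measure.toSphere_ne_zero _

/-- The surface measure of the unit sphere is invariant under linear isometries. -/
theorem integral_sphere_comp_isometry {n : ℕ} (hn : 1 ≤ n) (L : Euc n ≃ₗᵢ[ℝ] Euc n)
    {H : Euc n → ℝ} (hH : Continuous H) :
    ∫ θ : Metric.sphere (0 : Euc n) 1, H (L θ) ∂(volume : Measure (Euc n)).toSphere =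
      ∫ θ : Metric.sphere (0 : Euc n) 1, H θ ∂(volume : Measure (Euc n)).toSphere := by
  -- The sphere integral of `G` is, up to a positive factor, the integral over the ball of its
  -- extension homogeneous of degree zero. Invariance then comes from Lebesgue measure.
  have key (G : Euc n → ℝ) (hG : Continuous G) :
      ∫ x in Metric.ball (0 : Euc n) 1, G (‖x‖⁻¹ • x) = (∫ r in (0 : ℝ)..1, r ^ (n - 1)) *
        ∫ θ : Metric.sphere (0 : Euc n) 1, G θ ∂(volume : Measure (Euc n)).toSphere := by
    set F : Euc n → ℝ := (Metric.ball (0 : Euc n) 1).indicator fun x => G (‖x‖⁻¹ • x) with hF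
    have hmeas : Measurable fun x : Euc n => G (‖x‖⁻¹ • x) :=
      hG.measurable.comp (measurable_norm.inv.smul measurable_id)
    obtain ⟨M, hM⟩ := (isCompact_closedBall (0 : Euc n) 1).exists_bound_of_continuousOn
      hG.continuousOn
    have hFi : Integrable F := by
      rw [hF, integrable_indicator_iff measurableSet_ball]
      refine Measure.integrableOn_of_bounded (M := M) measure_ball_lt_top.ne
        hmeas.aestronglyMeasurable (Filter.Eventually.of_forall fun x => hM _ ?_)
      rw [mem_closedBall_zero_iff, norm_smul, norm_inv, norm_norm]
      exact inv_mul_le_one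
    rw [← integral_indicator measurableSet_ball, integral_eq_integral_sphereIntegral hn hFi,
      setIntegral_Ioi_eq_intervalIntegral zero_le_one, ← intervalIntegral.integral_mul_const]
    · refine intervalIntegral.integral_congr_ae ?_
      have hne : ∀ᵐ r : ℝ, r ≠ 1 := by simp [ae_iff, measure_singleton]
      filter_upwards [hne] with r hr1 hr
      rw [Set.uIoc_of_le zero_le_one] at hr
      have hlt : r < 1 := lt_of_le_of_ne hr.2 hr1
      congr 1
      refine integral_congr_ae (Filter.Eventually.of_forall fun θ => ?_)
      have hθ : ‖(θ : Euc n)‖ = 1 := by simp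
      have hmem : r • (θ : Euc n) ∈ Metric.ball (0 : Euc n) 1 := by
        rw [mem_ball_zero_iff, norm_smul, hθ, Real.norm_of_nonneg hr.1.le, mul_one]
        exact hlt
      simp only [F]
      rw [Set.indicator_of_mem hmem, norm_smul, hθ, Real.norm_of_nonneg hr.1.le, mul_one,
        smul_smul, inv_mul_cancel₀ hr.1.ne', one_smul]
    · intro s hs
      have : sphereIntegral F s = 0 := by
        refine integral_eq_zero_of_ae (Filter.Eventually.of_forall fun θ => ?_)
        refine Set.indicator_of_notMem ?_ _
        rw [mem_ball_zero_iff, norm_smul, Real.norm_of_nonneg (zero_le_one.trans hs)]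
        simpa using hs
      rw [this, mul_zero]
  have hpos : 0 < ∫ r in (0 : ℝ)..1, r ^ (n - 1) := by
    rw [integral_pow]; simp; positivity
  refine mul_left_cancel₀ hpos.ne' ?_
  rw [← key (fun x => H (L x)) (hH.comp L.continuous), ← key _ hH]
  have h1 := L.measurePreserving.setIntegral_preimage_emb L.toHomeomorph.measurableEmbedding
    (fun x => H (‖x‖⁻¹ • x)) (Metric.ball (0 : Euc n) 1)
  rw [← h1]
  have h2 : L ⁻¹' Metric.ball (0 : Euc n) 1 = Metric.ball (0 : Euc n) 1 := by
    ext x; simp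
  rw [h2]
  simp

/-- Two vectors of the same norm are exchanged by a linear isometry. -/
theorem exists_isometry_apply_eq {n : ℕ} {z w : Euc n} (h : ‖z‖ = ‖w‖) :
    ∃ L : Euc n ≃ₗᵢ[ℝ] Euc n, L z = w :=
  ⟨(ℝ ∙ (z - w))ᗮ.reflection, Submodule.reflection_sub h⟩

/-- The convolution at scale `ρ` of the averaging kernel with the sphere of radius `R`. -/
noncomputable def sphereKernel {n : ℕ} (R ρ : ℝ) (z : Euc n) : ℝ :=
  ∫ θ : Metric.sphere (0 : Euc n) 1, averagingKernel (ρ⁻¹ • (z - R • (θ : Euc n)))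
    ∂(volume : Measure (Euc n)).toSphere

/-- An isometry taking `z` to `w` preserves both the surface measure and the radial averaging
kernel. -/
theorem sphereKernel_eq_of_norm_eq {n : ℕ} (hn : 1 ≤ n) (R ρ : ℝ) {z w : Euc n}
    (h : ‖z‖ = ‖w‖) : sphereKernel R ρ z = sphereKernel R ρ w := by
  obtain ⟨L, rfl⟩ := exists_isometry_apply_eq h
  have hk := continuous_averagingKernel (n := n)
  unfold sphereKernel
  rw [← integral_sphere_comp_isometry hn L
    (H := fun x => averagingKernel (ρ⁻¹ • (L z - R • x))) (by fun_prop)]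
  congr 1
  funext θ
  rw [← map_smul, ← map_sub, ← map_smul, averagingKernel, averagingKernel, L.norm_map]

theorem sphereKernel_nonneg {n : ℕ} (R ρ : ℝ) (z : Euc n) : 0 ≤ sphereKernel R ρ z :=
  integral_nonneg fun _ => averagingKernel_nonneg _

theorem continuous_sphereKernel {n : ℕ} (R ρ : ℝ) : Continuous (sphereKernel (n := n) R ρ) := by
  have hk := continuous_averagingKernel (n := n)
  have := continuous_parametric_integral_of_continuous
    (μ := (volume : Measure (Euc n)).toSphere)
    (f := fun (z : Euc n) (θ : Metric.sphere (0 : Euc n) 1) =>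
      averagingKernel (ρ⁻¹ • (z - R • (θ : Euc n))))
    (by unfold Function.uncurry; fun_prop) isCompact_univ
  simp only [Measure.restrict_univ] at this
  exact this

theorem averagingKernel_rescaled_eq_zero {n : ℕ} {R ρ : ℝ} (hρ : 0 < ρ) (hR : 0 ≤ R) {z : Euc n}
    (hz : ρ ≤ |‖z‖ - R|) (θ : Metric.sphere (0 : Euc n) 1) :
    averagingKernel (ρ⁻¹ • (z - R • (θ : Euc n))) = 0 := by
  refine averagingKernel_eq_zero ?_
  have h1 : ‖R • (θ : Euc n)‖ = R := by simp [norm_smul, abs_of_nonneg hR]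
  have h2 := abs_norm_sub_norm_le z (R • (θ : Euc n))
  rw [h1] at h2
  rw [norm_smul, Real.norm_of_nonneg (inv_nonneg.2 hρ.le), ← div_eq_inv_mul, one_le_div hρ]
  exact hz.trans h2

theorem sphereKernel_eq_zero {n : ℕ} {R ρ : ℝ} (hρ : 0 < ρ) (hR : 0 ≤ R) {z : Euc n}
    (hz : ρ ≤ |‖z‖ - R|) : sphereKernel R ρ z = 0 :=
  integral_eq_zero_of_ae
    (Filter.Eventually.of_forall (averagingKernel_rescaled_eq_zero hρ hR hz))

/-- The average of `u` on the ball of centre `z` and radius `ρ` with respect to the averaging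
kernel, without normalization. -/
noncomputable def ballAverage {n : ℕ} (u : Euc n → ℝ) (ρ : ℝ) (z : Euc n) : ℝ :=
  ∫ y, u (z + ρ • y) * averagingKernel y

theorem ballAverage_eq_integral {n : ℕ} (u : Euc n → ℝ) {ρ : ℝ} (hρ : 0 < ρ) (z : Euc n) :
    ballAverage u ρ z = (ρ ^ n)⁻¹ * ∫ x, u x * averagingKernel (ρ⁻¹ • (x - z)) := by
  have h1 := integral_sub_right_eq_self (μ := (volume : Measure (Euc n)))
    (fun x => u (z + x) * averagingKernel (ρ⁻¹ • x)) z
  have h2 := Measure.integral_comp_inv_smul_of_nonneg (volume : Measure (Euc n))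
    (fun y => u (z + ρ • y) * averagingKernel y) hρ.le
  simp only [smul_inv_smul₀ hρ.ne', finrank_euclideanSpace_fin, smul_eq_mul] at h2
  simp only [add_sub_cancel] at h1
  rw [h1, h2, ballAverage, inv_mul_cancel_left₀ (by positivity)]

/-- The mean of ball averages over a sphere is a weighted mean of spherical means. -/
theorem sphereIntegral_ballAverage {n : ℕ} (hn : 1 ≤ n) {u : Euc n → ℝ} (hu : Continuous u)
    {R ρ : ℝ} (hρ : 0 < ρ) (hR : 0 ≤ R) {e : Euc n} (he : ‖e‖ = 1) :
    sphereIntegral (ballAverage u ρ) R = (ρ ^ n)⁻¹ *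
      ∫ s in Set.Ioi (0 : ℝ), s ^ (n - 1) * (sphereKernel R ρ (s • e) * sphereIntegral u s) := by
  have hk := continuous_averagingKernel (n := n)
  have hK := continuous_sphereKernel (n := n) R ρ
  have hfar {z : Euc n} (hz : z ∉ Metric.closedBall (0 : Euc n) (R + ρ)) : ρ ≤ |‖z‖ - R| := by
    rw [mem_closedBall_zero_iff, not_le] at hz
    exact le_trans (by linarith) (le_abs_self _)
  have hint : Integrable fun z => sphereKernel R ρ z * u z := by
    refine (hK.mul hu).integrable_of_hasCompactSupport ?_
    refine HasCompactSupport.intro (isCompact_closedBall (0 : Euc n) (R + ρ)) fun z hz => ?_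
    rw [Pi.mul_apply, sphereKernel_eq_zero hρ hR (hfar hz), zero_mul]
  -- Both sides of the theorem reduce to the integral of `u` against `sphereKernel`: the weight is
  -- radial, so `s • e` may stand for every point of norm `s`, and the other side follows from
  -- Fubini's theorem.
  have h1 : ∫ s in Set.Ioi (0 : ℝ), s ^ (n - 1) *
      (sphereKernel R ρ (s • e) * sphereIntegral u s) = ∫ z, sphereKernel R ρ z * u z := by
    rw [integral_eq_integral_sphereIntegral hn hint]
    refine setIntegral_congr_fun measurableSet_Ioi fun s _ => ?_
    congr 1
    unfold sphereIntegral
    rw [← integral_const_mul]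
    refine integral_congr_ae (Filter.Eventually.of_forall fun θ => ?_)
    simp only
    rw [sphereKernel_eq_of_norm_eq hn R ρ (z := s • e) (w := s • (θ : Euc n))
      (by simp [norm_smul, he])]
  rw [h1]
  unfold sphereIntegral
  simp_rw [ballAverage_eq_integral u hρ]
  rw [integral_const_mul]
  congr 1
  rw [integral_integral_swap_of_hasCompactSupport]
  · refine integral_congr_ae (Filter.Eventually.of_forall fun z => ?_)
    simp only [sphereKernel]
    rw [integral_const_mul, mul_comm]
  · unfold Function.uncurry; fun_prop
  · refine HasCompactSupport.intro (isCompact_univ.prod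
      (isCompact_closedBall (0 : Euc n) (R + ρ))) fun p hp => ?_
    have hz : p.2 ∉ Metric.closedBall (0 : Euc n) (R + ρ) := by simpa using hp
    simp only [Function.uncurry]
    rw [averagingKernel_rescaled_eq_zero hρ hR (hfar hz), mul_zero]

/-- The weights are nonnegative and vanish unless `R - ρ < s < R + ρ`. Applying
`sphereIntegral_ballAverage` to the constant function `1` computes their total mass. -/
theorem le_sphereIntegral_ballAverage {n : ℕ} (hn : 1 ≤ n) {u : Euc n → ℝ} (hu : Continuous u)
    {R ρ : ℝ} (hρ : 0 < ρ) (hρR : ρ ≤ R) {m : ℝ}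
    (hm : ∀ s, R - ρ ≤ s → s ≤ R + ρ → m ≤ sphereIntegral u s) :
    m * ∫ y : Euc n, averagingKernel y ≤ sphereIntegral (ballAverage u ρ) R := by
  have hR : 0 < R := hρ.trans_le hρR
  set e : Euc n := EuclideanSpace.single ⟨0, by omega⟩ 1 with he
  have hen : ‖e‖ = 1 := by simp [he]
  have hK := continuous_sphereKernel (n := n) R ρ
  set σ : ℝ := (volume : Measure (Euc n)).toSphere.real Set.univ with hσ
  have hσpos : 0 < σ := toSphere_real_univ_pos hn
  have hone := sphereIntegral_ballAverage hn (u := fun _ => 1) continuous_const hρ hR.le hen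
  have hu1 := sphereIntegral_ballAverage hn hu hρ hR.le hen
  have hc1 (s : ℝ) : sphereIntegral (fun _ : Euc n => (1 : ℝ)) s = σ := by
    simp [sphereIntegral, hσ]
  have hc2 : sphereIntegral (ballAverage (fun _ : Euc n => (1 : ℝ)) ρ) R =
      σ * ∫ y : Euc n, averagingKernel y := by
    simp [sphereIntegral, ballAverage, hσ]
  have hzero (s : ℝ) (hs : 0 ≤ s) (h : ρ ≤ |s - R|) : sphereKernel R ρ (s • e) = 0 :=
    sphereKernel_eq_zero hρ hR.le (by rwa [norm_smul, hen, mul_one, Real.norm_of_nonneg hs])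
  have hS := continuous_sphereIntegral hu
  have hfar (s : ℝ) (hs : R + ρ ≤ s) : sphereKernel R ρ (s • e) = 0 :=
    hzero s (by linarith) (le_trans (by linarith) (le_abs_self _))
  rw [setIntegral_Ioi_eq_intervalIntegral (b := R + ρ) (by linarith)
    (fun s hs => by rw [hfar s hs]; ring)] at hone hu1
  simp_rw [hc1] at hone
  rw [hc2] at hone
  have hone' : ∫ y : Euc n, averagingKernel y = (ρ ^ n)⁻¹ *
      ∫ s in (0 : ℝ)..(R + ρ), s ^ (n - 1) * sphereKernel R ρ (s • e) := by
    refine mul_left_cancel₀ hσpos.ne' ?_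
    rw [hone, mul_left_comm]
    congr 1
    rw [← intervalIntegral.integral_const_mul]
    congr 1
    funext s; ring
  rw [hu1, hone', mul_left_comm, ← intervalIntegral.integral_const_mul]
  refine mul_le_mul_of_nonneg_left ?_ (by positivity)
  refine intervalIntegral.integral_mono_on (by linarith)
    ((by fun_prop : Continuous fun s : ℝ =>
      m * (s ^ (n - 1) * sphereKernel R ρ (s • e))).intervalIntegrable _ _)
    ((by fun_prop : Continuous fun s : ℝ =>
      s ^ (n - 1) * (sphereKernel R ρ (s • e) * sphereIntegral u s)).intervalIntegrable _ _)
    fun s hs => ?_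
  by_cases h : s < R - ρ
  · rw [hzero s hs.1 (by rw [abs_of_neg (by linarith)]; linarith)]
    simp
  · have h1 := hm s (not_lt.1 h) hs.2
    have h2 := sphereKernel_nonneg R ρ (s • e)
    have h3 : 0 ≤ s ^ (n - 1) := pow_nonneg hs.1 _
    have := mul_le_mul_of_nonneg_left h1 (mul_nonneg h3 h2)
    linarith

/-! ### Pointwise lower bound by spherical means -/

theorem continuous_ballAverage {n : ℕ} {u : Euc n → ℝ} (hu : Continuous u) (ρ : ℝ) :
    Continuous (ballAverage u ρ) := by
  have hk := continuous_averagingKernel (n := n)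
  have h1 := continuous_parametric_integral_of_continuous
    (μ := (volume : Measure (Euc n)))
    (f := fun (z y : Euc n) => u (z + ρ • y) * averagingKernel y)
    (by unfold Function.uncurry; fun_prop) (isCompact_closedBall (0 : Euc n) 1)
  refine h1.congr fun z => ?_
  refine setIntegral_eq_integral_of_forall_compl_eq_zero fun y hy => ?_
  rw [mem_closedBall_zero_iff, not_le] at hy
  rw [averagingKernel_eq_zero hy.le, mul_zero]

theorem hasDerivAt_ballAverage_segment {n : ℕ} {u : Euc n → ℝ} (hu : ContDiff ℝ ∞ u) (ρ : ℝ)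
    (z w : Euc n) (t : ℝ) : HasDerivAt (fun t : ℝ => ballAverage u ρ (z + t • w))
      (∫ y, fderiv ℝ u (z + t • w + ρ • y) w * averagingKernel y) t := by
  have hud := hu.differentiable (by simp)
  have hf := continuous_fderiv_of_contDiff hu
  have huc := hu.continuous
  have hk := continuous_averagingKernel (n := n)
  refine hasDerivAt_integral_of_continuous
    (F := fun (t : ℝ) (y : Euc n) => u (z + t • w + ρ • y) * averagingKernel y)
    (F' := fun (t : ℝ) (y : Euc n) => fderiv ℝ u (z + t • w + ρ • y) w * averagingKernel y)
    (by unfold Function.uncurry; fun_prop) (by unfold Function.uncurry; fun_prop)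
    (fun t y => ?_) (isCompact_closedBall (0 : Euc n) 1) measurableSet_closedBall
    (fun t y hy => ?_) (fun t y hy => ?_) t
  · have h1 : HasDerivAt (fun t : ℝ => z + t • w + ρ • y) w t := by
      have := (((hasDerivAt_id t).smul_const w).const_add z).add_const (ρ • y)
      simpa using this
    exact ((hud (z + t • w + ρ • y)).hasFDerivAt.comp_hasDerivAt t h1).mul_const _
  all_goals
    rw [mem_closedBall_zero_iff, not_le] at hy
    rw [averagingKernel_eq_zero hy.le, mul_zero]

/-- The hypotheses of the local estimates hold after rescaling. -/
theorem rescaled_laplacian_inequality {n : ℕ} {u : Euc n → ℝ} (hu : ContDiff ℝ ∞ u) {c R₀ R ρ : ℝ}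
    (h : ∀ x, R₀ ≤ ‖x‖ → c * ‖fderiv ℝ u x‖ ^ 2 ≤ -Δ u x) (hρ : 0 < ρ)
    (hR : R₀ + 2 * ρ ≤ R) {z : Euc n} (hz : R ≤ ‖z‖) (y : Euc n) (hy : ‖y‖ ≤ 2) :
    c * ‖fderiv ℝ (fun y => u (z + ρ • y)) y‖ ^ 2 ≤ -Δ (fun y => u (z + ρ • y)) y := by
  rw [fderiv_comp_affine (hu.differentiable (by simp)), laplacian_comp_affine hu, norm_smul,
    Real.norm_of_nonneg hρ.le]
  have h1 : R₀ ≤ ‖z + ρ • y‖ := by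
    have := norm_sub_le_norm_add z (ρ • y)
    rw [norm_smul, Real.norm_of_nonneg hρ.le] at this
    have : ρ * ‖y‖ ≤ ρ * 2 := by gcongr
    linarith
  have := mul_le_mul_of_nonneg_left (h _ h1) (sq_nonneg ρ)
  linarith

/-- By orthogonality the squared norm is `R²((1-t)² + t²) ≥ R²/2`. Such a chord stays in the region
where the gradient estimate is available. -/
theorem norm_segment_ge {n : ℕ} {x e : Euc n} {R : ℝ} (hx : ‖x‖ = R) (he : ‖e‖ = R)
    (hxe : inner ℝ x e = 0) (t : ℝ) : R / 2 ≤ ‖x + t • (e - x)‖ := by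
  have hR : 0 ≤ R := hx ▸ norm_nonneg x
  refine le_of_sq_le_sq ?_ (norm_nonneg _)
  have e1 : x + t • (e - x) = (1 - t) • x + t • e := by module
  rw [e1, norm_add_sq_real, norm_smul, norm_smul, inner_smul_left, inner_smul_right, hxe, hx, he]
  simp only [Real.norm_eq_abs, mul_pow, sq_abs, mul_zero, add_zero]
  nlinarith [sq_nonneg (R * (2 * t - 1))]

/-- Any two points of a sphere are thus joined by two chords with orthogonal endpoints, both far
from the origin. Dimension three leaves room for a vector orthogonal to two given ones. -/
theorem exists_norm_eq_orthogonal {n : ℕ} (hn : 3 ≤ n) (x y : Euc n) {R : ℝ} (hR : 0 ≤ R) :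
    ∃ e : Euc n, ‖e‖ = R ∧ inner ℝ x e = 0 ∧ inner ℝ y e = 0 := by
  set S : Submodule ℝ (Euc n) := Submodule.span ℝ {x, y} with hS
  have hfin : Module.finrank ℝ S ≤ 2 := by
    classical
    have := finrank_span_finset_le_card (R := ℝ) ({x, y} : Finset (Euc n))
    rw [Finset.coe_insert, Finset.coe_singleton] at this
    exact this.trans Finset.card_le_two
  have hne : Sᗮ ≠ ⊥ := by
    intro h
    rw [Submodule.orthogonal_eq_bot_iff] at h
    rw [h, finrank_top, finrank_euclideanSpace_fin] at hfin
    omega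
  obtain ⟨w, hw, hw0⟩ := Submodule.exists_mem_ne_zero_of_ne_bot hne
  have hmem : (R * ‖w‖⁻¹) • w ∈ Sᗮ := Submodule.smul_mem _ _ hw
  refine ⟨(R * ‖w‖⁻¹) • w, ?_, ?_, ?_⟩
  · rw [norm_smul, Real.norm_of_nonneg (by positivity), mul_assoc,
      inv_mul_cancel₀ (norm_ne_zero_iff.2 hw0), mul_one]
  · exact (Submodule.mem_orthogonal _ _).1 hmem x (Submodule.subset_span (by simp))
  · exact (Submodule.mem_orthogonal _ _).1 hmem y (Submodule.subset_span (by simp))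

/-- A solution of `Δ u + c |∇u|² ≤ 0` near infinity is bounded from below by its spherical means,
up to an additive constant. -/
theorem exists_sphereIntegral_le {n : ℕ} (hn : 3 ≤ n) {u : Euc n → ℝ} (hu : ContDiff ℝ ∞ u)
    {c R₀ : ℝ} (hc : 0 < c) (h : ∀ x, R₀ ≤ ‖x‖ → c * ‖fderiv ℝ u x‖ ^ 2 ≤ -Δ u x) :
    ∃ C, ∀ R, 0 < R → 4 * R₀ ≤ R → ∀ m, (∀ s, R / 2 ≤ s → s ≤ 2 * R → m ≤ sphereIntegral u s) →
      ∀ x, ‖x‖ = R → m ≤ (volume : Measure (Euc n)).toSphere.real Set.univ * (u x + C) := by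
  obtain ⟨C, hC0, hC⟩ := exists_integral_norm_fderiv_le n hc
  set μ := ∫ y : Euc n, averagingKernel y with hμ
  have hμpos : 0 < μ := integral_averagingKernel_pos (by omega)
  set σ := (volume : Measure (Euc n)).toSphere.real Set.univ with hσ
  have hf := continuous_fderiv_of_contDiff hu
  -- Two chords of length at most `2R`, along which the ball average has gradient at most `C/ρ =
  -- 8C/R`, give the oscillation `32C`; `μ` normalizes the kernel.
  refine ⟨32 * C / μ, fun R hR hRR m hm x hx => ?_⟩
  -- A ball of radius `2ρ = R/4` centred at norm at least `R/2` stays outside radius `R/4 ≥ R₀`.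
  -- Moreover `[R - ρ, R + ρ]` lies in `[R/2, 2R]`.
  set ρ := R / 8 with hρd
  have hρ : 0 < ρ := by positivity
  have hgrad (z w : Euc n) (hz : R / 2 ≤ ‖z‖) :
      ‖∫ y, fderiv ℝ u (z + ρ • y) w * averagingKernel y‖ ≤ C / ρ * ‖w‖ := by
    have h1 := hC (fun y => u (z + ρ • y)) (by fun_prop)
      (rescaled_laplacian_inequality hu h hρ (R := R / 2) (by rw [hρd]; linarith) hz)
    have h2 : ∫ y, ‖fderiv ℝ (fun y => u (z + ρ • y)) y‖ * averagingKernel y =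
        ρ * ∫ y, ‖fderiv ℝ u (z + ρ • y)‖ * averagingKernel y := by
      rw [← integral_const_mul]
      congr 1
      funext y
      rw [fderiv_comp_affine (hu.differentiable (by simp)), norm_smul, Real.norm_of_nonneg hρ.le,
        mul_assoc]
    rw [h2, mul_comm, ← le_div_iff₀ hρ] at h1
    refine (norm_integral_le_of_norm_le (g := fun y =>
      ‖fderiv ℝ u (z + ρ • y)‖ * averagingKernel y * ‖w‖)
      ((integrable_mul_averagingKernel (by fun_prop)).mul_const _)
      (Filter.Eventually.of_forall fun y => ?_)).trans ?_
    · rw [norm_mul, Real.norm_of_nonneg (averagingKernel_nonneg y)]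
      have := mul_le_mul_of_nonneg_right ((fderiv ℝ u (z + ρ • y)).le_opNorm w)
        (averagingKernel_nonneg y)
      linarith
    · rw [integral_mul_const]
      gcongr
  have hseg (z e : Euc n) (hz : ‖z‖ = R) (he : ‖e‖ = R) (hze : inner ℝ z e = 0) :
      |ballAverage u ρ e - ballAverage u ρ z| ≤ 16 * C := by
    have := norm_image_sub_le_of_norm_deriv_le_segment_01'
      (f := fun t : ℝ => ballAverage u ρ (z + t • (e - z)))
      (C := C / ρ * ‖e - z‖)
      (fun t _ => (hasDerivAt_ballAverage_segment hu ρ z (e - z) t).hasDerivWithinAt)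
      (fun t _ => hgrad _ _ (norm_segment_ge hz he hze t))
    simp only [one_smul, add_sub_cancel, zero_smul, add_zero, Real.norm_eq_abs] at this
    refine this.trans ?_
    have h2 : ‖e - z‖ ≤ 2 * R := (norm_sub_le _ _).trans (by rw [hz, he]; linarith)
    calc C / ρ * ‖e - z‖ ≤ C / ρ * (2 * R) := by gcongr
      _ = 16 * C := by rw [hρd]; field_simp; ring
  have hosc (z : Euc n) (hz : ‖z‖ = R) : ballAverage u ρ z - 32 * C ≤ ballAverage u ρ x := by
    obtain ⟨e, he, h1, h2⟩ := exists_norm_eq_orthogonal hn x z hR.le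
    have h3 := abs_le.1 (hseg x e hx he h1)
    have h4 := abs_le.1 (hseg z e hz he h2)
    linarith [h3.2, h4.1]
  have hmv : ballAverage u ρ x ≤ u x * μ := by
    have := integral_mul_averagingKernel_le (v := fun y => u (x + ρ • y)) (by fun_prop)
      (fun y hy => by
        have := rescaled_laplacian_inequality hu h hρ (R := R) (by rw [hρd]; linarith) hx.ge y
          (by linarith)
        have h0 : 0 ≤ c * ‖fderiv ℝ (fun y => u (x + ρ • y)) y‖ ^ 2 := by positivity
        linarith)
    simpa [ballAverage] using this
  have hlow := le_sphereIntegral_ballAverage (by omega : 1 ≤ n) hu.continuous (R := R) hρ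
    (by rw [hρd]; linarith) (m := m) fun s h1 h2 =>
      hm s (by rw [hρd] at h1; linarith) (by rw [hρd] at h2; linarith)
  have hup : sphereIntegral (ballAverage u ρ) R ≤ σ * (u x * μ + 32 * C) := by
    have hc := continuous_ballAverage hu.continuous ρ
    have h1 : sphereIntegral (ballAverage u ρ) R ≤
        ∫ _ : Metric.sphere (0 : Euc n) 1, (u x * μ + 32 * C)
          ∂(volume : Measure (Euc n)).toSphere := by
      refine integral_mono ?_ (integrable_const _) fun θ => ?_
      · exact (by fun_prop : Continuous fun θ : Metric.sphere (0 : Euc n) 1 =>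
          ballAverage u ρ (R • (θ : Euc n))).integrable_of_hasCompactSupport
          (HasCompactSupport.of_compactSpace _)
      · have := hosc (R • (θ : Euc n)) (by simp [norm_smul, abs_of_pos hR])
        simp only
        linarith
    simpa [hσ] using h1
  have h5 : m * μ ≤ σ * (u x + 32 * C / μ) * μ := by
    have : σ * (u x + 32 * C / μ) * μ = σ * (u x * μ + 32 * C) := by field_simp
    linarith
  exact le_of_mul_le_mul_right h5 hμpos

/-! ### Distance of the conformal metric and a completeness criterion -/

theorem tangentLength_conformalMetric {n : ℕ} (u : Euc n → ℝ) (x v : Euc n) :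
    tangentLength (conformalMetric u) x v = Real.exp (u x) * ‖v‖ := by
  have h : ∑ i, ∑ j, conformalMetric u x i j * v i * v j = (Real.exp (u x) * ‖v‖) ^ 2 := by
    rw [mul_pow, EuclideanSpace.norm_sq_eq, Finset.mul_sum]
    refine Finset.sum_congr rfl fun i _ => ?_
    rw [Finset.sum_eq_single i
      (fun j _ hj => by simp [conformalMetric, Matrix.one_apply_ne hj.symm])
      (by simp), ← Real.exp_nat_mul]
    simp [conformalMetric]
    ring
  rw [tangentLength, h, Real.sqrt_sq (by positivity)]

theorem pathELength_conformalMetric {n : ℕ} (u : Euc n → ℝ) (γ : ℝ → Euc n) (a b : ℝ) :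
    letI := tangentENorm (conformalMetric u)
    Manifold.pathELength 𝓘(ℝ, Euc n) γ a b =
      ∫⁻ t in Set.Icc a b, ENNReal.ofReal (Real.exp (u (γ t)) * ‖deriv γ t‖) := by
  let _ := tangentENorm (conformalMetric u)
  rw [Manifold.pathELength_eq_lintegral_mfderiv_Icc]
  refine lintegral_congr fun t => ?_
  rw [← tangentLength_conformalMetric, ← fderiv_apply_one_eq_deriv, ← mfderiv_eq_fderiv]
  rfl

/-- The distance of the conformal metric is at most the length of a straight segment. -/
theorem geodesicEDist_conformalMetric_le {n : ℕ} (u : Euc n → ℝ) {x y : Euc n} {M : ℝ}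
    (hM : ∀ t ∈ Set.Icc (0 : ℝ) 1, Real.exp (u (x + t • (y - x))) ≤ M) :
    geodesicEDist (conformalMetric u) x y ≤ ENNReal.ofReal (M * ‖y - x‖) := by
  let _ := tangentENorm (conformalMetric u)
  have _ := tangentENorm_smulClass (conformalMetric u)
  have hγ : ContDiff ℝ 1 fun t : ℝ => x + t • (y - x) := by fun_prop
  have h1 : geodesicEDist (conformalMetric u) x y ≤
      Manifold.pathELength 𝓘(ℝ, Euc n) (fun t : ℝ => x + t • (y - x)) 0 1 :=
    Manifold.riemannianEDist_le_pathELength (contMDiffOn_iff_contDiffOn.2 hγ.contDiffOn)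
      (by simp) (by simp) zero_le_one
  refine h1.trans ?_
  rw [pathELength_conformalMetric]
  have hd (t : ℝ) : deriv (fun t : ℝ => x + t • (y - x)) t = y - x := by
    have : HasDerivAt (fun t : ℝ => x + t • (y - x)) (y - x) t := by
      simpa using ((hasDerivAt_id t).smul_const (y - x)).const_add x
    exact this.deriv
  calc _ ≤ ∫⁻ _ in Set.Icc (0 : ℝ) 1, ENNReal.ofReal (M * ‖y - x‖) := by
        refine setLIntegral_mono measurable_const fun t ht => ?_
        rw [hd]
        exact ENNReal.ofReal_le_ofReal (by have := hM t ht; gcongr)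
    _ = _ := by simp

/-- A function whose gradient is dominated by the conformal factor is `1`-Lipschitz for the distance
of the conformal metric. -/
theorem ofReal_abs_sub_le_geodesicEDist {n : ℕ} {u : Euc n → ℝ} {F : Euc n → ℝ}
    (hF : ContDiff ℝ 1 F) (h : ∀ x, ‖fderiv ℝ F x‖ ≤ Real.exp (u x)) (x y : Euc n) :
    ENNReal.ofReal |F y - F x| ≤ geodesicEDist (conformalMetric u) x y := by
  let _ := tangentENorm (conformalMetric u)
  refine le_of_forall_gt fun r hr => ?_
  obtain ⟨γ, h0, h1, hγ, hlen⟩ := Manifold.exists_lt_of_riemannianEDist_lt hr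
  refine lt_of_le_of_lt ?_ hlen
  rw [contMDiffOn_iff_contDiffOn] at hγ
  rw [pathELength_conformalMetric, ← restrict_Ioo_eq_restrict_Icc]
  have hG : ContDiffOn ℝ 1 (F ∘ γ) (Set.Icc 0 1) := hF.comp_contDiffOn hγ
  have hd (t : ℝ) (ht : t ∈ Set.Ioo (0 : ℝ) 1) :
      HasDerivAt (F ∘ γ) (fderiv ℝ F (γ t) (deriv γ t)) t := by
    have h2 : DifferentiableAt ℝ γ t :=
      (hγ.differentiableOn (by simp)).differentiableAt (Icc_mem_nhds ht.1 ht.2)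
    exact ((hF.differentiable (by simp)) (γ t)).hasFDerivAt.comp_hasDerivAt t h2.hasDerivAt
  -- The curve is `C¹` only on `[0, 1]`, so integrability is taken from `derivWithin`, which is
  -- continuous there and agrees with `deriv` in the interior.
  have hint : IntegrableOn (deriv (F ∘ γ)) (Set.Ioo 0 1) := by
    have h3 := (hG.continuousOn_derivWithin (uniqueDiffOn_Icc zero_lt_one)
      (by simp)).integrableOn_Icc (μ := volume)
    refine (h3.mono_set Set.Ioo_subset_Icc_self).congr_fun (fun t ht => ?_) measurableSet_Ioo
    exact derivWithin_of_mem_nhds (Icc_mem_nhds ht.1 ht.2)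
  have hftc : ∫ t in (0 : ℝ)..1, deriv (F ∘ γ) t = F y - F x := by
    rw [intervalIntegral.integral_eq_sub_of_hasDerivAt_of_le zero_le_one hG.continuousOn
      (fun t ht => (hd t ht).differentiableAt.hasDerivAt)
      ((intervalIntegrable_iff_integrableOn_Ioo_of_le zero_le_one).2 hint)]
    simp [h0, h1]
  rw [← hftc, intervalIntegral.integral_of_le zero_le_one, ← Real.enorm_eq_ofReal_abs,
    ← restrict_Ioo_eq_restrict_Ioc]
  refine (enorm_integral_le_lintegral_enorm _).trans ?_
  refine setLIntegral_mono' measurableSet_Ioo fun t ht => ?_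
  rw [(hd t ht).deriv, Real.enorm_eq_ofReal_abs]
  refine ENNReal.ofReal_le_ofReal ?_
  exact ((fderiv ℝ F (γ t)).le_opNorm _).trans (by have := h (γ t); gcongr)

/-- A conformal metric whose factor dominates `a / (1 + |x|)` is complete. -/
theorem isCompleteMetric_of_exp_ge {n : ℕ} {u : Euc n → ℝ} (hu : Continuous u) {a : ℝ}
    (ha : 0 < a) (h : ∀ x, a / (1 + ‖x‖) ≤ Real.exp (u x)) :
    IsCompleteMetric (conformalMetric u) := by
  -- A smooth proper substitute for `log (1 + |x|)`. Its gradient has norm `a|x|/(2(1+|x|²))`, which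
  -- is at most `a/(1+|x|)`.
  set F : Euc n → ℝ := fun x => a / 4 * Real.log (1 + ‖x‖ ^ 2) with hFdef
  have hpos (x : Euc n) : 0 < 1 + ‖x‖ ^ 2 := by positivity
  have hF : ContDiff ℝ 1 F :=
    contDiff_const.mul ((contDiff_const.add (contDiff_norm_sq ℝ)).log fun x => (hpos x).ne')
  have hgrad (x : Euc n) : ‖fderiv ℝ F x‖ ≤ Real.exp (u x) := by
    refine le_trans ?_ (h x)
    have h1 : HasFDerivAt F ((a / 4) • ((1 + ‖x‖ ^ 2)⁻¹ • (2 • innerSL ℝ x))) x :=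
      (((hasStrictFDerivAt_norm_sq x).hasFDerivAt.const_add 1).log (hpos x).ne').const_mul (a / 4)
    rw [h1.fderiv, norm_smul, norm_smul, ← Nat.cast_smul_eq_nsmul ℝ 2, norm_smul,
      innerSL_apply_norm,
      Real.norm_of_nonneg (by positivity), Real.norm_of_nonneg (by positivity)]
    have hx := norm_nonneg x
    simp only [Nat.cast_ofNat, Real.norm_ofNat]
    rw [le_div_iff₀ (by positivity), show a / 4 * ((1 + ‖x‖ ^ 2)⁻¹ * (2 * ‖x‖)) * (1 + ‖x‖) =
      a * (2 * ‖x‖ * (1 + ‖x‖)) / (4 * (1 + ‖x‖ ^ 2)) by field_simp,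
      div_le_iff₀ (by positivity)]
    refine mul_le_mul_of_nonneg_left ?_ ha.le
    nlinarith [sq_nonneg (‖x‖ - 1)]
  let inst : PseudoEMetricSpace (Euc n) := geodesicSpace (conformalMetric u)
  refine @EMetric.complete_of_cauchySeq_tendsto (Euc n) inst fun s hs => ?_
  have hcauchy : ∀ ε > 0, ∃ N, ∀ i, N ≤ i → ∀ j, N ≤ j →
      geodesicEDist (conformalMetric u) (s i) (s j) < ε :=
    (@EMetric.cauchySeq_iff (Euc n) ℕ inst _ _ s).1 hs
  obtain ⟨N, hN⟩ := hcauchy 1 one_pos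
  have hbdd (k : ℕ) : ‖s (N + k)‖ ^ 2 ≤ Real.exp (4 / a * (F (s N) + 1)) := by
    have h1 := (ofReal_abs_sub_le_geodesicEDist hF hgrad (s N) (s (N + k))).trans_lt
      (hN N le_rfl (N + k) (by omega))
    rw [← ENNReal.ofReal_one, ENNReal.ofReal_lt_ofReal_iff one_pos] at h1
    have h2 := (abs_lt.1 h1).2
    have h3 : Real.log (1 + ‖s (N + k)‖ ^ 2) ≤ 4 / a * (F (s N) + 1) := by
      have : 4 / a * F (s (N + k)) = Real.log (1 + ‖s (N + k)‖ ^ 2) := by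
        simp only [hFdef]; field_simp
      rw [← this]
      gcongr
      linarith
    rw [Real.log_le_iff_le_exp (hpos _)] at h3
    linarith
  set B := √(Real.exp (4 / a * (F (s N) + 1))) with hB
  -- A Cauchy sequence has bounded `F`, hence is bounded in the Euclidean norm and has a Euclidean
  -- limit point. Straight segments in the ball, where `e^u ≤ M`, turn this into convergence of a
  -- subsequence for the geodesic distance.
  obtain ⟨x, hx, φ, hφ, hlim⟩ := (isCompact_closedBall (0 : Euc n) B).tendsto_subseq
    (x := fun k => s (N + k)) fun k => by
      rw [mem_closedBall_zero_iff]
      exact Real.le_sqrt_of_sq_le (hbdd k)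
  obtain ⟨M, hM⟩ := (isCompact_closedBall (0 : Euc n) B).exists_bound_of_continuousOn
    (Real.continuous_exp.comp hu).continuousOn
  have hdist (k : ℕ) : geodesicEDist (conformalMetric u) (s (N + k)) x ≤
      ENNReal.ofReal (M * ‖x - s (N + k)‖) := by
    refine geodesicEDist_conformalMetric_le u fun t ht => (le_abs_self _).trans (hM _ ?_)
    have h1 : s (N + k) ∈ Metric.closedBall (0 : Euc n) B := by
      rw [mem_closedBall_zero_iff]; exact Real.le_sqrt_of_sq_le (hbdd k)
    exact (convex_closedBall (0 : Euc n) B).add_smul_sub_mem h1 hx ht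
  have hdist0 : Filter.Tendsto (fun k => geodesicEDist (conformalMetric u) (s (N + φ k)) x)
      Filter.atTop (nhds 0) := by
    refine tendsto_of_tendsto_of_tendsto_of_le_of_le tendsto_const_nhds ?_ (fun _ => zero_le)
      (fun k => hdist (φ k))
    have h2 : Filter.Tendsto (fun k => M * ‖x - s (N + φ k)‖) Filter.atTop (nhds 0) := by
      have := ((tendsto_const_nhds (x := x)).sub hlim).norm.const_mul M
      simpa using this
    simpa using ENNReal.tendsto_ofReal h2
  refine ⟨x, ?_⟩
  have hsub : @Filter.Tendsto ℕ (Euc n) (fun k => s (N + φ k)) Filter.atTop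
      (@nhds (Euc n) inst.toUniformSpace.toTopologicalSpace x) :=
    (@tendsto_iff_edist_tendsto_0 (Euc n) ℕ inst _ _ _).2 hdist0
  have hφN : Filter.Tendsto (fun k => N + φ k) Filter.atTop Filter.atTop :=
    Filter.tendsto_atTop_mono (fun k => Nat.le_add_left _ _) hφ.tendsto_atTop
  let _ : UniformSpace (Euc n) := inst.toUniformSpace
  exact tendsto_nhds_of_cauchySeq_of_subseq hs hφN hsub

/-! ### The critical constant, growth of spherical means, conclusion -/

theorem toSphere_real_univ_eq {n : ℕ} (hn : 1 ≤ n) :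
    (volume : Measure (Euc n)).toSphere.real Set.univ =
      n * (√Real.pi ^ n / Real.Gamma (n / 2 + 1)) := by
  have : Nonempty (Fin n) := ⟨⟨0, by omega⟩⟩
  have hG : 0 < Real.Gamma (n / 2 + 1) := Real.Gamma_pos_of_pos (by positivity)
  rw [Measure.toSphere_real_apply_univ, finrank_euclideanSpace_fin, Measure.real,
    EuclideanSpace.volume_ball]
  simp [ENNReal.toReal_ofReal (by positivity :
    0 ≤ √Real.pi ^ n / Real.Gamma (n / 2 + 1))]

/-- Identifies the threshold for the total Q-curvature as the value for which `r` times the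
derivative of the spherical integral tends to `-|𝕊^{n-1}|`. The half-integer value of `Gamma` gives
a double factorial, which cancels against the odd part of `(2m-1)!`. -/
theorem factorial_mul_sphereVolume {m : ℕ} (hm : 1 ≤ m) :
    ((2 * m - 1).factorial : ℝ) * sphereVolume (2 * m) / 2 =
      (volume : Measure (Euc (2 * m))).toSphere.real Set.univ *
        (2 ^ (m - 1) * (m - 1).factorial) ^ 2 := by
  obtain ⟨k, rfl⟩ : ∃ k, m = k + 1 := ⟨m - 1, by omega⟩
  rw [sphereVolume, toSphere_real_univ_eq (by omega), toSphere_real_univ_eq (by omega)]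
  have e1 : (((2 * (k + 1) + 1 : ℕ) : ℝ) / 2 + 1) = ((k + 2 : ℕ) : ℝ) + 1 / 2 := by
    push_cast; ring
  have e2 : (((2 * (k + 1) : ℕ) : ℝ) / 2 + 1) = ((k + 1 : ℕ) : ℝ) + 1 := by
    push_cast; ring
  rw [e1, e2, Real.Gamma_nat_add_half, Real.Gamma_nat_eq_factorial,
    show 2 * (k + 1) - 1 = 2 * k + 1 by omega, show 2 * (k + 2) - 1 = 2 * (k + 1) + 1 by omega,
    show k + 1 - 1 = k by omega, Nat.factorial_succ k]
  have f1 : (2 * k + 1).factorial = (2 * k + 1).doubleFactorial * (2 ^ k * k.factorial) := by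
    rw [Nat.factorial_eq_mul_doubleFactorial, Nat.doubleFactorial_two_mul]
  have f2 : (2 * (k + 1) + 1).doubleFactorial = (2 * k + 3) * (2 * k + 1).doubleFactorial := by
    rw [show 2 * (k + 1) + 1 = (2 * k + 1) + 2 by ring, Nat.doubleFactorial_add_two]
  rw [f1, f2]
  have hd : ((2 * k + 1).doubleFactorial : ℝ) ≠ 0 := by
    exact_mod_cast (Nat.doubleFactorial_pos _).ne'
  have hk : (k.factorial : ℝ) ≠ 0 := by exact_mod_cast k.factorial_ne_zero
  have hpi : √Real.pi ≠ 0 := by positivity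
  push_cast
  field_simp
  ring

/-- Cauchy–Schwarz against the constant `1`, obtained by expanding the integral of `(σ f - A)² ≥ 0`.
-/
theorem sq_integral_le_measure_mul_integral_sq {α : Type*} [MeasurableSpace α] {μ : Measure α}
    [IsFiniteMeasure μ] {f : α → ℝ} (hf : Integrable f μ) (hf2 : Integrable (fun x => f x ^ 2) μ)
    (hμ : 0 < μ.real Set.univ) :
    (∫ x, f x ∂μ) ^ 2 ≤ μ.real Set.univ * ∫ x, f x ^ 2 ∂μ := by
  set A := ∫ x, f x ∂μ with hA
  set σ := μ.real Set.univ with hσ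
  have h0 : 0 ≤ ∫ x, (σ * f x - A) ^ 2 ∂μ := integral_nonneg fun x => sq_nonneg _
  have h1 : ∫ x, (σ * f x - A) ^ 2 ∂μ = σ * (σ * ∫ x, f x ^ 2 ∂μ - A ^ 2) := by
    have i1 : Integrable (fun x => σ ^ 2 * f x ^ 2 - 2 * σ * A * f x) μ :=
      (hf2.const_mul _).sub (hf.const_mul _)
    have e : ∫ x, (σ * f x - A) ^ 2 ∂μ =
        ∫ x, (σ ^ 2 * f x ^ 2 - 2 * σ * A * f x + A ^ 2) ∂μ := by
      congr 1; funext x; ring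
    rw [e, integral_add i1 (integrable_const _), integral_sub (hf2.const_mul _) (hf.const_mul _),
      integral_const_mul, integral_const_mul, integral_const, smul_eq_mul, ← hA, ← hσ]
    ring
  rw [h1] at h0
  linarith [nonneg_of_mul_nonneg_right h0 hμ]

/-- The Riccati inequality satisfied by the spherical means of a solution of
`Δ u + c |∇u|² ≤ 0`. -/
theorem mul_sphereFlux_sq_le {n : ℕ} (hn : 1 ≤ n) {u : Euc n → ℝ} (hu : ContDiff ℝ ∞ u)
    {c r : ℝ} (hc : 0 < c) (hr : 0 ≤ r)
    (h : ∀ x, r = ‖x‖ → c * ‖fderiv ℝ u x‖ ^ 2 ≤ -Δ u x) :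
    c / (volume : Measure (Euc n)).toSphere.real Set.univ * sphereFlux u r ^ 2 ≤
      sphereIntegral (-Δ u) r := by
  have hf := continuous_fderiv_of_contDiff hu
  have hL := (contDiff_laplacian hu).continuous
  have hσ := toSphere_real_univ_pos hn
  have hint {g : Metric.sphere (0 : Euc n) 1 → ℝ} (hg : Continuous g) :
      Integrable g (volume : Measure (Euc n)).toSphere :=
    hg.integrable_of_hasCompactSupport (HasCompactSupport.of_compactSpace _)
  have h1 := sq_integral_le_measure_mul_integral_sq
    (hint (g := fun θ => fderiv ℝ u (r • (θ : Euc n)) θ) (by fun_prop)) (hint (by fun_prop)) hσ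
  have h2 : c * ∫ θ : Metric.sphere (0 : Euc n) 1, fderiv ℝ u (r • (θ : Euc n)) θ ^ 2
      ∂(volume : Measure (Euc n)).toSphere ≤ sphereIntegral (-Δ u) r := by
    rw [← integral_const_mul]
    refine integral_mono (hint (by fun_prop)) (hint ?_) fun θ => ?_
    · exact hL.neg.comp (by fun_prop)
    · have hθ : ‖(θ : Euc n)‖ = 1 := by simp
      refine le_trans ?_ (h (r • (θ : Euc n))
        (by rw [norm_smul, hθ, mul_one, Real.norm_of_nonneg hr]))
      have h3 := (fderiv ℝ u (r • (θ : Euc n))).le_opNorm θ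
      rw [hθ, mul_one, Real.norm_eq_abs] at h3
      have h4 := pow_le_pow_left₀ (abs_nonneg _) h3 2
      rw [sq_abs] at h4
      exact mul_le_mul_of_nonneg_left h4 hc.le
  rw [div_mul_eq_mul_div, div_le_iff₀ hσ]
  calc _ ≤ c * (_ * _) := mul_le_mul_of_nonneg_left h1 hc.le
    _ = _ := mul_left_comm _ _ _
    _ ≤ _ := mul_le_mul_of_nonneg_left h2 hσ.le
    _ = _ := mul_comm _ _

/-- The asymptotics of the radial derivative of the spherical means, in terms of the total
Q-curvature. -/
theorem tendsto_mul_sphereFlux {m : ℕ} (hm : 2 ≤ m) {u : Euc (2 * m) → ℝ} (hu : ContDiff ℝ ∞ u)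
    (hQ : Integrable ((fun f : Euc (2 * m) → ℝ => -Δ f)^[m] u)) {c R₀ : ℝ} (hc : 0 < c)
    (h : ∀ x, R₀ ≤ ‖x‖ → c * ‖fderiv ℝ u x‖ ^ 2 ≤ -Δ u x) :
    Filter.Tendsto (fun r => r * sphereFlux u r) Filter.atTop
      (nhds (-((∫ x, (fun f : Euc (2 * m) → ℝ => -Δ f)^[m] u x) /
        (2 ^ (m - 1) * (m - 1).factorial) ^ 2))) := by
  set w : ℕ → Euc (2 * m) → ℝ := fun k => (fun f : Euc (2 * m) → ℝ => -Δ f)^[k] u with hw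
  have hws (k : ℕ) : ContDiff ℝ ∞ (w k) := contDiff_iterate_neg_laplacian hu k
  have hsucc (k : ℕ) : w (k + 1) = -Δ (w k) := Function.iterate_succ_apply' _ _ _
  have hneg (f : Euc (2 * m) → ℝ) (s : ℝ) : sphereIntegral (-f) s = -sphereIntegral f s := by
    simp only [sphereIntegral, Pi.neg_apply, integral_neg]
  refine tendsto_mul_deriv_of_radial_system hm (v := fun k => sphereIntegral (w k))
    (p := fun k => sphereFlux (w k)) (fun k r => hasDerivAt_sphereIntegral (hws k) r)
    (fun k => continuous_sphereFlux (hws k)) (fun k r hr => ?_) ?_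
    (c := c / (volume : Measure (Euc (2 * m))).toSphere.real Set.univ)
    (div_pos hc (toSphere_real_univ_pos (by omega))) ?_
  · rw [pow_mul_sphereFlux (by omega) (hws k) hr]
    simp only [hsucc, hneg, mul_neg, intervalIntegral.integral_neg, neg_neg]
  · rw [integral_eq_integral_sphereIntegral (by omega) hQ]
    exact intervalIntegral_tendsto_integral_Ioi 0
      (integrableOn_sphereIntegral (by omega) hQ) Filter.tendsto_id
  · filter_upwards [Filter.eventually_ge_atTop R₀, Filter.eventually_ge_atTop 0] with r hr hr0
    rw [hsucc 0]
    exact mul_sphereFlux_sq_le (by omega) hu hc hr0 fun x hx => h x (hx ▸ hr)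

/-- Under the strict bound on the total Q-curvature, the spherical means of `u` decay at most like
`-log r`. -/
theorem eventually_neg_log_le_sphereIntegral {m : ℕ} (hm : 2 ≤ m) {u : Euc (2 * m) → ℝ}
    (hu : ContDiff ℝ ∞ u) (hQ : Integrable ((fun f : Euc (2 * m) → ℝ => -Δ f)^[m] u)) {c R₀ : ℝ}
    (hc : 0 < c) (h : ∀ x, R₀ ≤ ‖x‖ → c * ‖fderiv ℝ u x‖ ^ 2 ≤ -Δ u x)
    (hlt : ∫ x, (fun f : Euc (2 * m) → ℝ => -Δ f)^[m] u x <
      ((2 * m - 1).factorial : ℝ) * sphereVolume (2 * m) / 2) :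
    ∃ C, ∀ᶠ r in Filter.atTop,
      -(volume : Measure (Euc (2 * m))).toSphere.real Set.univ * Real.log r - C ≤
        sphereIntegral u r := by
  set σ := (volume : Measure (Euc (2 * m))).toSphere.real Set.univ with hσ
  rw [factorial_mul_sphereVolume (by omega)] at hlt
  have hlim := tendsto_mul_sphereFlux hm hu hQ hc h
  have hgt : -σ < -((∫ x, (fun f : Euc (2 * m) → ℝ => -Δ f)^[m] u x) /
        (2 ^ (m - 1) * (m - 1).factorial) ^ 2) := by
    rw [neg_lt_neg_iff, div_lt_iff₀ (by positivity)]
    exact hlt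
  refine exists_sub_le_of_eventually_deriv_le (f := sphereIntegral u)
    (g := fun r => -σ * Real.log r)
    (Filter.Eventually.of_forall fun r => hasDerivAt_sphereIntegral hu r)
    ((Filter.eventually_gt_atTop 0).mono fun r hr =>
      (Real.hasDerivAt_log hr.ne').const_mul (-σ)) ?_
  filter_upwards [hlim.eventually_const_lt hgt, Filter.eventually_gt_atTop 0] with r h1 h2
  rw [← div_eq_mul_inv, div_le_iff₀ h2]
  linarith

/-- Far out, the logarithmic bound for spherical means becomes pointwise through
`exists_sphereIntegral_le`; on the remaining ball compactness suffices. -/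
theorem exists_exp_ge {m : ℕ} (hm : 2 ≤ m) {u : Euc (2 * m) → ℝ}
    (hu : ContDiff ℝ ∞ u) (hQ : Integrable ((fun f : Euc (2 * m) → ℝ => -Δ f)^[m] u)) {c R₀ : ℝ}
    (hc : 0 < c) (h : ∀ x, R₀ ≤ ‖x‖ → c * ‖fderiv ℝ u x‖ ^ 2 ≤ -Δ u x)
    (hlt : ∫ x, (fun f : Euc (2 * m) → ℝ => -Δ f)^[m] u x <
      ((2 * m - 1).factorial : ℝ) * sphereVolume (2 * m) / 2) :
    ∃ a > 0, ∀ x, a / (1 + ‖x‖) ≤ Real.exp (u x) := by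
  obtain ⟨C₁, hC₁⟩ := eventually_neg_log_le_sphereIntegral hm hu hQ hc h hlt
  obtain ⟨R₁, hR₁⟩ := Filter.eventually_atTop.1 hC₁
  obtain ⟨C₂, hC₂⟩ := exists_sphereIntegral_le (by omega) hu hc h
  set σ := (volume : Measure (Euc (2 * m))).toSphere.real Set.univ with hσ
  have hσpos : 0 < σ := toSphere_real_univ_pos (by omega)
  set R := max 1 (max (4 * R₀) (2 * R₁)) with hR
  have hlarge (x : Euc (2 * m)) (hx : R ≤ ‖x‖) :
      Real.exp (-(C₁ / σ + C₂)) / 2 / (1 + ‖x‖) ≤ Real.exp (u x) := by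
    have hx1 : 1 ≤ ‖x‖ := (le_max_left _ _).trans hx
    have hx2 : 4 * R₀ ≤ ‖x‖ := ((le_max_left _ _).trans (le_max_right _ _)).trans hx
    have hx3 : 2 * R₁ ≤ ‖x‖ := ((le_max_right _ _).trans (le_max_right _ _)).trans hx
    -- The lower bound must hold for all radii in `[|x|/2, 2|x|]`, so the logarithm is taken at the
    -- largest one, `2|x|`.
    have key := hC₂ ‖x‖ (by linarith) hx2 (-σ * Real.log (2 * ‖x‖) - C₁) (fun s h1 h2 => by
      refine le_trans ?_ (hR₁ s (by linarith))
      have := Real.log_le_log (by linarith) h2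
      have := mul_le_mul_of_nonneg_left this hσpos.le
      linarith) x rfl
    have h1 : -Real.log (2 * ‖x‖) - (C₁ / σ + C₂) ≤ u x := by
      have : σ * (-Real.log (2 * ‖x‖) - (C₁ / σ + C₂)) ≤ σ * u x := by
        have : σ * (C₁ / σ) = C₁ := by field_simp
        linarith
      exact le_of_mul_le_mul_left this hσpos
    refine le_trans ?_ (Real.exp_le_exp.2 h1)
    rw [sub_eq_add_neg, Real.exp_add, Real.exp_neg (Real.log _), Real.exp_log (by linarith),
      div_div, ← div_eq_inv_mul]
    gcongr
    linarith
  obtain ⟨x₀, -, hx₀⟩ := (isCompact_closedBall (0 : Euc (2 * m)) R).exists_isMinOn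
    ⟨0, Metric.mem_closedBall_self (zero_le_one.trans (le_max_left _ _))⟩
    (Real.continuous_exp.comp hu.continuous).continuousOn
  refine ⟨min (Real.exp (-(C₁ / σ + C₂)) / 2) (Real.exp (u x₀)),
    lt_min (by positivity) (Real.exp_pos _), fun x => ?_⟩
  rcases le_total R ‖x‖ with hx | hx
  · refine le_trans ?_ (hlarge x hx)
    gcongr
    exact min_le_left _ _
  · have h1 : Real.exp (u x₀) ≤ Real.exp (u x) := hx₀ (mem_closedBall_zero_iff.2 hx)
    refine le_trans ((div_le_self (by positivity) ?_).trans (min_le_right _ _)) h1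
    linarith [norm_nonneg x]

theorem qCurvature_mul_exp {n : ℕ} (u : Euc n → ℝ) (x : Euc n) :
    qCurvature u x * Real.exp (n * u x) = (fun f : Euc n → ℝ => -Δ f)^[n / 2] u x := by
  rw [qCurvature, mul_right_comm, ← Real.exp_add, neg_add_cancel, Real.exp_zero, one_mul]

theorem mainTheorem11 (n : ℕ) (hn : 4 ≤ n) (hn_even : Even n)
    (u : Euc n → ℝ) (hu : ContDiff ℝ ∞ u)
    (hQ : Integrable (fun x => qCurvature u x * Real.exp (n * u x)))
    (hR : ∃ K : Set (Euc n), IsCompact K ∧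
      ∀ x ∉ K, 0 ≤ scalarCurvature (conformalMetric u) x)
    (hlt : ∫ x, qCurvature u x * Real.exp (n * u x) <
      ((n - 1).factorial : ℝ) * sphereVolume n / 2) :
    IsCompleteMetric (conformalMetric u) := by
  simp_rw [qCurvature_mul_exp] at hQ hlt
  obtain ⟨K, hK, hKR⟩ := hR
  obtain ⟨R, hR⟩ := hK.isBounded.exists_norm_le
  obtain ⟨m, rfl⟩ := hn_even.two_dvd
  rw [Nat.mul_div_cancel_left m two_pos] at hQ hlt
  have hn' : (4 : ℝ) ≤ (2 * m : ℕ) := by exact_mod_cast hn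
  -- The radius `R + 1` puts points with `R₀ ≤ |x|` strictly beyond the bound `R` for `K`, hence
  -- outside `K`.
  obtain ⟨a, ha, hexp⟩ := exists_exp_ge (by omega) hu hQ (c := (((2 * m : ℕ) : ℝ) - 2) / 2)
    (R₀ := R + 1) (by linarith) (fun x hx => laplacian_le_of_scalarCurvature_nonneg (by omega) hu
      (hKR x fun hxK => by linarith [hR x hxK])) hlt
  exact isCompleteMetric_of_exp_ge hu.continuous ha hexp
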